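/- Conventions. A group is freely indecomposable if it is non-trivial and is not a free product of two non-trivial groups. Let $\mathcal F$ be the class of groups $H$ that are free products $H=\ast_{i=1}^{n}H_i$ of finitely many factors ($n\ge 0$, the case $n=0$ being the trivial group) such that every finite-index subgroup of each $H_i$ is freely indecomposable (in particular each $H_i$ is infinite), and let $\mathrm V\mathcal F$ be the class of groups that have a finite-index subgroup in $\mathcal F$. For $G\in \mathrm V\mathcal F$, a finite-index subgroup $H\le G$ in $\mathcal F$, and a splitting $H=\ast_{i=1}^{n}H_i$ as above, put $$\omega(G)=\frac{1-n}{[G:H]}\in\mathbb Q .$$ **Corollary 3.6.** Let $(\mathcal G,Y)$ be a finite connected graph of groups with vertex groups $G_u$ and finite edge groups $G_e$, and let $G$ be its fundamental group. Here $VY$ is the set of vertices of $Y$, and $EY$ is the set of its geometric (unoriented) edges. (i) Suppose that every vertex group is in $\mathrm V\mathcal F$, and that each vertex group is residually finite or virtually torsion free. Then $G\in \mathrm V\mathcal F$, the number $\omega(G)$ does not depend on the choice of $H$ and of its splitting, and $$\omega(G)=\sum_{u\in VY}\omega(G_u)-\sum_{e\in EY}\frac1{|G_e|}.$$ (ii)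 Suppose that $Y$ has at least one edge, and that all vertex groups are infinite, nilpotent and virtually torsion free. Then any two isomorphic finite-index subgroups of $G$ have the same index in $G$. -/

import Mathlib

/-! ### Free products, the class `𝓕`, the class `V𝓕`, and the invariant `ω` -/

/-- A group is freely indecomposable if it is non-trivial and it is not the (internal) free product
of two non-trivial subgroups. -/
def FreelyIndecomposable (A : Type*) [Group A] : Prop :=
  Nontrivial A ∧ ∀ B C : Subgroup A,
    Function.Bijective (Monoid.Coprod.lift B.subtype C.subtype) → B = ⊥ ∨ C = ⊥

/-- `H` is the internal free product of the family of subgroups `K`. -/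
def IsInternalFreeProduct {H : Type*} [Group H] {ι : Type*} (K : ι → Subgroup H) : Prop :=
  Function.Bijective (Monoid.CoprodI.lift fun i => (K i).subtype)

/-- `H` is a free product of `n` factors such that all the finite index subgroups of each factor
are freely indecomposable (so each factor is infinite, since `⊥` is not freely indecomposable).
The case `n = 0` is that of the trivial group. -/
def HasFSplitting (H : Type*) [Group H] (n : ℕ) : Prop :=
  ∃ K : Fin n → Subgroup H, IsInternalFreeProduct K ∧
    ∀ i, ∀ L : Subgroup (K i), L.FiniteIndex → FreelyIndecomposable L

/-- The class `𝓕`. -/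
def InF (H : Type*) [Group H] : Prop := ∃ n, HasFSplitting H n

/-- The class `V𝓕`. -/
def InVF (G : Type*) [Group G] : Prop := ∃ H : Subgroup G, H.FiniteIndex ∧ InF H

/-- `q` is the number `(1 - n) / [G : H]` computed from some finite index subgroup `H` of `G` in `𝓕`
and some splitting of `H` into `n` factors. -/
def IsOmegaValue (G : Type*) [Group G] (q : ℚ) : Prop :=
  ∃ (H : Subgroup G) (n : ℕ), H.FiniteIndex ∧ HasFSplitting H n ∧ q = (1 - (n : ℚ)) / (H.index : ℚ)

open Classical in
/-- The invariant `ω : V𝓕 → ℚ` (with the irrelevant value `0` outside `V𝓕`). -/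
noncomputable def omega (G : Type*) [Group G] : ℚ :=
  if h : ∃ q, IsOmegaValue G q then h.choose else 0

/-- `G` has a torsion free subgroup of finite index. -/
def VirtuallyTorsionFree (G : Type*) [Group G] : Prop :=
  ∃ H : Subgroup G, H.FiniteIndex ∧ ∀ h ∈ H, IsOfFinOrder h → h = 1

/-! ### Graphs of groups -/

/-- A graph of groups with vertex groups `G v` and edge groups `C e`. The type `E` contains each
geometric edge once, with a chosen orientation from `src e` to `tgt e`; loops and multiple edges
are allowed. -/
structure GraphOfGroups {V E : Type*} (G : V → Type*) [∀ v, Group (G v)]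
    (C : E → Type*) [∀ e, Group (C e)] where
  src : E → V
  tgt : E → V
  srcHom : ∀ e, C e →* G (src e)
  tgtHom : ∀ e, C e →* G (tgt e)
  srcHom_injective : ∀ e, Function.Injective (srcHom e)
  tgtHom_injective : ∀ e, Function.Injective (tgtHom e)

namespace GraphOfGroups

variable {V E : Type*} {G : V → Type*} [∀ v, Group (G v)] {C : E → Type*} [∀ e, Group (C e)]

/-- Two vertices are joined by an (unoriented) path with edges in `S`. -/
def Joined (Y : GraphOfGroups G C) (S : Set E) : V → V → Prop :=
  Relation.EqvGen fun u v => ∃ e ∈ S, Y.src e = u ∧ Y.tgt e = v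

/-- The edges in `T`, together with all the vertices, form a tree: they form a non-empty connected
graph, and no edge of `T` lies on a circuit of `T`. -/
def IsSpanningTree (Y : GraphOfGroups G C) (T : Set E) : Prop :=
  Nonempty V ∧ (∀ u v, Y.Joined T u v) ∧ ∀ e ∈ T, ¬ Y.Joined (T \ {e}) (Y.src e) (Y.tgt e)

/-- The free product of all the vertex groups and of the free group on the edges. -/
abbrev PreGroup (_Y : GraphOfGroups G C) : Type _ :=
  Monoid.Coprod (Monoid.CoprodI G) (FreeGroup E)

/-- The inclusion of a vertex group. -/
def ofVertex (Y : GraphOfGroups G C) (v : V) : G v →* Y.PreGroup :=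
  Monoid.Coprod.inl.comp Monoid.CoprodI.of

/-- The stable letter of an edge. -/
def stableLetter (Y : GraphOfGroups G C) (e : E) : Y.PreGroup :=
  Monoid.Coprod.inr (FreeGroup.of e)

/-- The defining relators: `t_e c t_e⁻¹ = c` for `c` in an edge group `C e`, embedded in
the vertex group of `tgt e` on the left and of `src e` on the right, and `t_e = 1` for `e ∈ T`. -/
def relators (Y : GraphOfGroups G C) (T : Set E) : Set Y.PreGroup :=
  {x | ∃ (e : E) (c : C e), x =
      Y.stableLetter e * Y.ofVertex (Y.tgt e) (Y.tgtHom e c) * (Y.stableLetter e)⁻¹ *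
        (Y.ofVertex (Y.src e) (Y.srcHom e c))⁻¹} ∪
  {x | ∃ e ∈ T, x = Y.stableLetter e}

/-- The fundamental group of a graph of groups with respect to a spanning tree `T`. -/
abbrev FundamentalGroup (Y : GraphOfGroups G C) (T : Set E) : Type _ :=
  Y.PreGroup ⧸ Subgroup.normalClosure (Y.relators T)

end GraphOfGroups

/-! ### Multigraphs -/

/-! The core is a structure theorem for subgroups `L` of the fundamental group that meet every
conjugate of every edge group trivially. Such an `L` is the free product of conjugates of subgroups
of the vertex groups, one for each orbit of a vertex group on the coset space of `L`, and of a free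
group on the edges outside a spanning tree of the quotient graph. It is proved without trees or
coverings: a cocycle on the coset space, with values in the candidate free product, restricts on the
stabilizer of a point to the inverse of the evident homorphism (`exists_orbitProduct_equiv`,
`exists_subgroup_equiv`).

If `L` has finite index `d`, freeness of the edge group actions puts `d / |C e|` edges over `e`. If
moreover `L` is normal and meets `G u` in `N u`, there are `d / [G u : N u]` vertices over `u`. With
`n u` factors in `N u`, the Euler characteristic of the quotient graph turns the number `n` of
factors of `L` into `1 - n = ∑ u, d / [G u : N u] * (1 - n u) - ∑ e, d / |C e|`; division by `d` is
the formula. A suitable `L` is the kernel of an action on a finite set, glued from actions of the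
vertex groups (`exists_normal_comap_eq`).

For independence of choices, a star with trivial edge groups gives the Kurosh theorem. It shows that
`1 - n` is multiplicative in the index (`HasFSplitting.subgroup`) and that `n` is determined by the
group (`HasFSplitting.unique`).

For (ii), infinite nilpotent groups are hereditarily indecomposable, so they have `ω = 0` and `ω` of
the fundamental group is negative. Multiplicativity then recovers the index of a subgroup from its
isomorphism type. -/

/-- Removing `a` separates its ends, so `k` may be corrected on the component of `tgt a` alone.
Right multiplication by a constant there preserves the equations of the other edges. This is what
later makes cocycles trivial on the tree `T`. -/
theorem exists_coboundary_of_forest {V E K : Type*} [Group K] (src tgt : E → V) {T : Set E}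
    (hfin : T.Finite)
    (hT : ∀ e ∈ T, ¬ Relation.EqvGen (fun u v => ∃ e' ∈ T \ {e}, src e' = u ∧ tgt e' = v)
      (src e) (tgt e)) (q : E → K) :
    ∃ k : V → K, ∀ e ∈ T, k (src e) = q e * k (tgt e) := by
  classical
  induction T, hfin using Set.Finite.induction_on with
  | empty => exact ⟨1, by simp⟩
  | @insert a S ha _ ih =>
    obtain ⟨k, hk⟩ := ih fun e he h => hT e (Set.mem_insert_of_mem _ he)
      (h.mono (by
        rintro u v ⟨e', ⟨h1, h2⟩, h3⟩
        exact ⟨e', ⟨Set.mem_insert_of_mem _ h1, h2⟩, h3⟩))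
    have hS : insert a S \ {a} = S := by
      ext x; constructor
      · rintro ⟨h1 | h1, h2⟩
        · exact absurd h1 h2
        · exact h1
      · intro h; exact ⟨Or.inr h, fun h' => ha (h' ▸ h)⟩
    have hsep := hT a (Set.mem_insert _ _)
    rw [hS] at hsep
    set R := Relation.EqvGen (fun u v => ∃ e' ∈ S, src e' = u ∧ tgt e' = v) with hR
    refine ⟨fun v => if R (tgt a) v then k v * (k (tgt a))⁻¹ * (q a)⁻¹ * k (src a) else k v, ?_⟩
    rintro e (rfl | he)
    · have h1 : R (tgt e) (tgt e) := Relation.EqvGen.refl _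
      have h2 : ¬ R (tgt e) (src e) := fun h => hsep (Relation.EqvGen.symm _ _ h)
      simp only [h1, h2, if_true, if_false]
      group
    · have h1 : R (src e) (tgt e) := Relation.EqvGen.rel _ _ ⟨e, he, rfl, rfl⟩
      have h2 : R (tgt a) (src e) ↔ R (tgt a) (tgt e) :=
        ⟨fun h => Relation.EqvGen.trans _ _ _ h h1,
          fun h => Relation.EqvGen.trans _ _ _ h (Relation.EqvGen.symm _ _ h1)⟩
      by_cases h : R (tgt a) (tgt e)
      · simp only [h2, h, if_true, hk e he, mul_assoc]
      · simp only [h2, h, if_false, hk e he]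

/-- A spanning tree of a multigraph, rooted at `v₀`, given by the edge `par v` that joins each
vertex `v ≠ v₀` to its parent. -/
structure RootedSpanningTree {V E : Type*} (src tgt : E → V) (v₀ : V) where
  height : V → ℕ
  par : {v // v ≠ v₀} → E
  par_spec : ∀ v : {v // v ≠ v₀}, (src (par v) = v ∧ height (tgt (par v)) < height v) ∨
    (tgt (par v) = v ∧ height (src (par v)) < height v)

namespace RootedSpanningTree

variable {V E : Type*} {src tgt : E → V} {v₀ : V}

theorem nonempty (h : ∀ v, Relation.EqvGen (fun u v => ∃ e, src e = u ∧ tgt e = v) v₀ v) :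
    Nonempty (RootedSpanningTree src tgt v₀) := by
  classical
  -- `S n` is the ball of radius `n` around `v₀`; the height will be the distance to `v₀`.
  let S : ℕ → Set V := fun n => Nat.rec {v₀}
    (fun _ A => A ∪ {v | ∃ e, (src e = v ∧ tgt e ∈ A) ∨ (tgt e = v ∧ src e ∈ A)}) n
  have hS : ∀ n, S (n + 1) =
    S n ∪ {v | ∃ e, (src e = v ∧ tgt e ∈ S n) ∨ (tgt e = v ∧ src e ∈ S n)} := fun n => rfl
  have hcl : ∀ e, (∃ n, src e ∈ S n) ↔ (∃ n, tgt e ∈ S n) := fun e =>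
    ⟨fun ⟨n, hn⟩ => ⟨n + 1, Or.inr ⟨e, Or.inr ⟨rfl, hn⟩⟩⟩,
      fun ⟨n, hn⟩ => ⟨n + 1, Or.inr ⟨e, Or.inl ⟨rfl, hn⟩⟩⟩⟩
  have hiff : ∀ u v, Relation.EqvGen (fun u v => ∃ e, src e = u ∧ tgt e = v) u v →
      ((∃ n, u ∈ S n) ↔ (∃ n, v ∈ S n)) := by
    intro u v huv
    induction huv with
    | rel u v h => obtain ⟨e, rfl, rfl⟩ := h; exact hcl e
    | refl => rfl
    | symm _ _ _ ih => exact ih.symm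
    | trans _ _ _ _ _ h1 h2 => exact h1.trans h2
  have hall : ∀ v, ∃ n, v ∈ S n ∧ ∀ m, v ∈ S m → n ≤ m := fun v => by
    have h1 : ∃ n, v ∈ S n := (hiff v₀ v (h v)).1 ⟨0, rfl⟩
    exact ⟨Nat.find h1, Nat.find_spec h1, fun m hm => Nat.find_min' h1 hm⟩
  choose d hd hmin using hall
  have key : ∀ v : {v // v ≠ v₀}, ∃ e, (src e = v ∧ d (tgt e) < d v) ∨
      (tgt e = v ∧ d (src e) < d v) := by
    rintro ⟨v, hv⟩
    have h1 := hd v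
    rcases hn : d v with _ | n
    · rw [hn] at h1; exact absurd h1 hv
    · rw [hn, hS] at h1
      rcases h1 with h1 | ⟨e, h1⟩
      · have := hmin v n h1; omega
      · refine ⟨e, h1.imp ?_ ?_⟩ <;> rintro ⟨h2, h3⟩ <;>
          exact ⟨h2, by have := hmin _ _ h3; omega⟩
  choose par hpar using key
  exact ⟨⟨d, par, hpar⟩⟩

variable (t : RootedSpanningTree src tgt v₀)

/-- The edges of the tree. -/
def edges : Set E := Set.range t.par

theorem par_injective : Function.Injective t.par := by
  rintro ⟨v, hv⟩ ⟨w, hw⟩ h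
  rcases t.par_spec ⟨v, hv⟩ with ⟨h1, h2⟩ | ⟨h1, h2⟩ <;>
  rcases t.par_spec ⟨w, hw⟩ with ⟨h3, h4⟩ | ⟨h3, h4⟩ <;> rw [h] at h1 h2 <;> grind

/-- Recursion on the height instead of induction on the edges: the quotient graph is infinite when
the subgroup has infinite index. The value at the root is free. -/
theorem exists_coboundary {K : Type*} [Group K] (q : E → K) (z : K) :
    ∃ k : V → K, k v₀ = z ∧ ∀ e ∈ t.edges, k (src e) = q e * k (tgt e) := by
  classical
  let F : (v : V) → ((w : V) → t.height w < t.height v → K) → K := fun v ih =>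
    if hv : v = v₀ then z else
      if h : src (t.par ⟨v, hv⟩) = v ∧ t.height (tgt (t.par ⟨v, hv⟩)) < t.height v then
        q (t.par ⟨v, hv⟩) * ih _ h.2
      else if h : tgt (t.par ⟨v, hv⟩) = v ∧ t.height (src (t.par ⟨v, hv⟩)) < t.height v then
        (q (t.par ⟨v, hv⟩))⁻¹ * ih _ h.2 else 1
  let k : V → K := (measure t.height).wf.fix F
  have hk : ∀ v, k v = F v fun w _ => k w := fun v => WellFounded.fix_eq _ _ _
  refine ⟨k, ?_, ?_⟩
  · rw [hk]; simp [F]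
  · rintro _ ⟨⟨v, hv⟩, rfl⟩
    have h1 := hk v
    by_cases h : src (t.par ⟨v, hv⟩) = v ∧ t.height (tgt (t.par ⟨v, hv⟩)) < t.height v
    · simp only [F, dif_neg hv, dif_pos h] at h1
      rw [← h1, h.1]
    · have h2 := (t.par_spec ⟨v, hv⟩).resolve_left h
      simp only [F, dif_neg hv, dif_neg h, dif_pos h2] at h1
      rw [h2.1, h1]; group

theorem induction {p : V → Prop} (h₀ : p v₀) (h : ∀ e ∈ t.edges, p (src e) ↔ p (tgt e)) (v : V) :
    p v := by
  induction hn : t.height v using Nat.strong_induction_on generalizing v with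
  | _ n ih =>
    by_cases hv : v = v₀
    · exact hv ▸ h₀
    · have he := h (t.par ⟨v, hv⟩) ⟨_, rfl⟩
      rcases t.par_spec ⟨v, hv⟩ with ⟨h1, h2⟩ | ⟨h1, h2⟩
      · rw [h1] at he; exact he.2 (ih _ (hn ▸ h2) _ rfl)
      · rw [h1] at he; exact he.1 (ih _ (hn ▸ h2) _ rfl)

theorem card_compl_edges [Finite V] [Finite E] :
    Nat.card (t.edgesᶜ : Set E) + Nat.card V = Nat.card E + 1 := by
  classical
  have h1 : t.edges.ncard = Nat.card {v // v ≠ v₀} := by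
    rw [← Nat.card_coe_set_eq, edges, Nat.card_range_of_injective t.par_injective]
  have h0 := Set.ncard_add_ncard_compl ({v₀} : Set V)
  rw [Set.ncard_singleton, ← Nat.card_coe_set_eq] at h0
  have h3 : Nat.card (({v₀}ᶜ : Set V)) = Nat.card {v // v ≠ v₀} := rfl
  have h2 := Set.ncard_add_ncard_compl t.edges
  rw [Nat.card_coe_set_eq]; omega

end RootedSpanningTree

/-! ### The fundamental group: universal property and cocycles -/

namespace GraphOfGroups

variable {V E : Type*} {G : V → Type*} [∀ v, Group (G v)] {C : E → Type*} [∀ e, Group (C e)]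
  (Y : GraphOfGroups G C) (T : Set E)

/-- The canonical homomorphism of a vertex group to the fundamental group. -/
def vertexHom (v : V) : G v →* Y.FundamentalGroup T :=
  (QuotientGroup.mk' _).comp (Y.ofVertex v)

/-- The element of the fundamental group given by an edge. -/
def edgeElt (e : E) : Y.FundamentalGroup T := QuotientGroup.mk' _ (Y.stableLetter e)

theorem edgeElt_mul (e : E) (c : C e) :
    Y.edgeElt T e * Y.vertexHom T _ (Y.tgtHom e c) =
      Y.vertexHom T _ (Y.srcHom e c) * Y.edgeElt T e := by
  have : (QuotientGroup.mk' (Subgroup.normalClosure (Y.relators T))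
      (Y.stableLetter e * Y.ofVertex (Y.tgt e) (Y.tgtHom e c) * (Y.stableLetter e)⁻¹ *
        (Y.ofVertex (Y.src e) (Y.srcHom e c))⁻¹)) = 1 :=
    (QuotientGroup.eq_one_iff _).2 (Subgroup.subset_normalClosure (Or.inl ⟨e, c, rfl⟩))
  simp only [map_mul, map_inv] at this
  rw [mul_inv_eq_one, mul_inv_eq_iff_eq_mul] at this
  exact this

theorem edgeElt_eq_one {e : E} (he : e ∈ T) : Y.edgeElt T e = 1 :=
  (QuotientGroup.eq_one_iff _).2 (Subgroup.subset_normalClosure (Or.inr ⟨e, he, rfl⟩))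

variable {T} in
/-- The homomorphism from the fundamental group given by its presentation. -/
def fundLift {K : Type*} [Group K] (f : ∀ v, G v →* K) (t : E → K)
    (h : ∀ e c, t e * f _ (Y.tgtHom e c) = f _ (Y.srcHom e c) * t e) (h' : ∀ e ∈ T, t e = 1) :
    Y.FundamentalGroup T →* K :=
  QuotientGroup.lift _ (Monoid.Coprod.lift (Monoid.CoprodI.lift f) (FreeGroup.lift t)) <| by
    refine Subgroup.normalClosure_le_normal ?_
    rintro x (⟨e, c, rfl⟩ | ⟨e, he, rfl⟩)
    · simp [MonoidHom.mem_ker, stableLetter, ofVertex, h]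
    · simp [MonoidHom.mem_ker, stableLetter, h' e he]

section lift

variable {T} {K : Type*} [Group K] (f : ∀ v, G v →* K) (t : E → K)
    (h : ∀ e c, t e * f _ (Y.tgtHom e c) = f _ (Y.srcHom e c) * t e) (h' : ∀ e ∈ T, t e = 1)

@[simp] theorem fundLift_vertexHom (v : V) (g : G v) :
    Y.fundLift f t h h' (Y.vertexHom T v g) = f v g := by
  simp [fundLift, vertexHom, ofVertex]

@[simp] theorem fundLift_edgeElt (e : E) : Y.fundLift f t h h' (Y.edgeElt T e) = t e := by
  simp [fundLift, edgeElt, stableLetter]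

end lift

variable {T} in
theorem fund_induction {p : Y.FundamentalGroup T → Prop} (one : p 1)
    (vertex : ∀ v g, p (Y.vertexHom T v g)) (edge : ∀ e, p (Y.edgeElt T e))
    (mul : ∀ a b, p a → p b → p (a * b)) (inv : ∀ a, p a → p a⁻¹) (x) : p x := by
  let S : Subgroup (Y.FundamentalGroup T) :=
    { carrier := {x | p x}, one_mem' := one, mul_mem' := fun ha hb => mul _ _ ha hb,
      inv_mem' := fun ha => inv _ ha }
  suffices h : S.comap (QuotientGroup.mk' _) = ⊤ by
    obtain ⟨y, rfl⟩ := QuotientGroup.mk'_surjective _ x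
    have : y ∈ S.comap (QuotientGroup.mk' _) := h ▸ Subgroup.mem_top y
    exact this
  rw [eq_top_iff, ← Monoid.Coprod.range_inl_sup_range_inr]
  refine sup_le ?_ ?_
  · rintro _ ⟨y, rfl⟩
    induction y using Monoid.CoprodI.induction_on with
    | one => rw [map_one]; exact one_mem _
    | of v g => exact vertex v g
    | mul a b ha hb => rw [map_mul]; exact mul_mem ha hb
  · rintro _ ⟨y, rfl⟩
    induction y using FreeGroup.induction_on with
    | C1 => rw [map_one]; exact one_mem _
    | of e => exact edge e
    | inv_of e he => rw [map_inv]; exact inv_mem he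
    | mul a b ha hb => rw [map_mul]; exact mul_mem ha hb

/-- Cocycles on the vertex groups, compatible along the edges, extend to the fundamental group. -/
theorem exists_cocycle {X K : Type*} [Group K] [MulAction (Y.FundamentalGroup T) X]
    (a : ∀ v, G v → X → K) (τ : E → X → K)
    (ha : ∀ v g h x, a v (g * h) x = a v g (Y.vertexHom T v h • x) * a v h x)
    (hτ : ∀ e c x, τ e (Y.vertexHom T _ (Y.tgtHom e c) • x) * a _ (Y.tgtHom e c) x =
      a _ (Y.srcHom e c) (Y.edgeElt T e • x) * τ e x)
    (hT : ∀ e ∈ T, ∀ x, τ e x = 1) :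
    ∃ c : Y.FundamentalGroup T → X → K, (∀ g h x, c (g * h) x = c g (h • x) * c h x) ∧
      (∀ v g x, c (Y.vertexHom T v g) x = a v g x) ∧ ∀ e x, c (Y.edgeElt T e) x = τ e x := by
  have ha1 : ∀ v x, a v 1 x = 1 := fun v x => by simpa using ha v 1 1 x
  -- A cocycle is the same as an action on `X × K` over `X` of the form `(x, k) ↦ (g • x, c g x *
  -- k)`. Actions extend by the universal property of the presentation, and this form survives
  -- products and inverses.
  let A : ∀ v, MulAction (G v) (X × K) := fun v =>
    { smul := fun g y => (Y.vertexHom T v g • y.1, a v g y.1 * y.2)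
      one_smul := fun y => by
        change (Y.vertexHom T v 1 • y.1, a v 1 y.1 * y.2) = y
        simp [ha1]
      mul_smul := fun g h y => by
        change (Y.vertexHom T v (g * h) • y.1, a v (g * h) y.1 * y.2) =
          (Y.vertexHom T v g • Y.vertexHom T v h • y.1, a v g (Y.vertexHom T v h • y.1) *
            (a v h y.1 * y.2))
        simp [ha, mul_smul, mul_assoc] }
  let f : ∀ v, G v →* Equiv.Perm (X × K) := fun v => @MulAction.toPermHom _ _ _ (A v)
  have hf : ∀ v g x k, f v g (x, k) = (Y.vertexHom T v g • x, a v g x * k) := fun _ _ _ _ => rfl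
  let t : E → Equiv.Perm (X × K) := fun e =>
    { toFun := fun y => (Y.edgeElt T e • y.1, τ e y.1 * y.2)
      invFun := fun y => ((Y.edgeElt T e)⁻¹ • y.1, (τ e ((Y.edgeElt T e)⁻¹ • y.1))⁻¹ * y.2)
      left_inv := fun y => by simp
      right_inv := fun y => by simp }
  have ht : ∀ e x k, t e (x, k) = (Y.edgeElt T e • x, τ e x * k) := fun _ _ _ => rfl
  let θ := Y.fundLift (T := T) f t
    (fun e c => by
      ext1 ⟨x, k⟩
      rw [Equiv.Perm.mul_apply, Equiv.Perm.mul_apply, hf, ht, ht, hf, ← mul_smul, edgeElt_mul,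
        ← mul_smul, ← mul_assoc, hτ, mul_assoc])
    (fun e he => by
      ext1 ⟨x, k⟩
      simp [ht, Y.edgeElt_eq_one T he, hT e he])
  have key : ∀ g, ∃ b : X → K, ∀ x k, θ g (x, k) = (g • x, b x * k) := by
    intro g
    induction g using Y.fund_induction with
    | one => exact ⟨1, by simp⟩
    | vertex v g => exact ⟨a v g, fun x k => by rw [Y.fundLift_vertexHom, hf]⟩
    | edge e => exact ⟨τ e, fun x k => by rw [Y.fundLift_edgeElt, ht]⟩
    | mul g h ihg ihh =>
      obtain ⟨b, hb⟩ := ihg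
      obtain ⟨d, hd⟩ := ihh
      exact ⟨fun x => b (h • x) * d x, fun x k => by
        rw [map_mul, Equiv.Perm.mul_apply, hd, hb, mul_smul, mul_assoc]⟩
    | inv g ihg =>
      obtain ⟨b, hb⟩ := ihg
      exact ⟨fun x => (b (g⁻¹ • x))⁻¹, fun x k => by
        rw [map_inv, Equiv.Perm.inv_eq_iff_eq, hb]; simp⟩
  choose c hc using key
  refine ⟨c, fun g h x => ?_, fun v g x => ?_, fun e x => ?_⟩
  · have h1 := hc (g * h) x 1
    rw [map_mul, Equiv.Perm.mul_apply, hc, hc] at h1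
    simpa using (congrArg Prod.snd h1).symm
  · have h1 := hc (Y.vertexHom T v g) x 1
    rw [Y.fundLift_vertexHom, hf] at h1
    simpa using (congrArg Prod.snd h1).symm
  · have h1 := hc (Y.edgeElt T e) x 1
    rw [Y.fundLift_edgeElt, ht] at h1
    simpa using (congrArg Prod.snd h1).symm

end GraphOfGroups

/-! ### Orbit representatives -/

section orbits

variable (A : Type*) {X : Type*} [Group A] [MulAction A X]

/-- The class of a point modulo the action of `A`. -/
abbrev orbitClass (x : X) : MulAction.orbitRel.Quotient A X := Quotient.mk'' x

variable {A} in
theorem orbitClass_smul (g : A) (x : X) : orbitClass A (g • x) = orbitClass A x :=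
  Quotient.sound' (MulAction.mem_orbit x g)

theorem exists_smul_out (x : X) : ∃ g : A, g • (orbitClass A x).out = x :=
  (Quotient.eq''.1 (Quotient.out_eq' (orbitClass A x)).symm : x ∈ MulAction.orbit A _)

open Classical in
/-- A group element that moves the representative of the orbit of `x` to `x`. -/
noncomputable def orbitElt (x : X) : A :=
  -- The value `1` at representatives makes the cocycles below take their intended values there
  -- exactly, not just up to conjugation.
  if x = (orbitClass A x).out then 1 else (exists_smul_out A x).choose

theorem orbitElt_smul (x : X) : orbitElt A x • (orbitClass A x).out = x := by
  unfold orbitElt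
  split_ifs with h
  · rw [one_smul]; exact h.symm
  · exact (exists_smul_out A x).choose_spec

theorem orbitClass_out (q : MulAction.orbitRel.Quotient A X) : orbitClass A q.out = q :=
  Quotient.out_eq' q

theorem orbitElt_out (q : MulAction.orbitRel.Quotient A X) : orbitElt A q.out = 1 := by
  unfold orbitElt
  rw [if_pos]
  rw [orbitClass_out]

-- For a free action the element moving the representative to `x` is unique, hence equivariant in
-- `x`.
variable {A} in
theorem orbitElt_smul_of_free (h : ∀ (g : A) (x : X), g • x = x → g = 1) (g : A) (x : X) :
    orbitElt A (g • x) = g * orbitElt A x := by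
  have h1 := orbitElt_smul A (g • x)
  rw [orbitClass_smul] at h1
  have h2 := orbitElt_smul A x
  have h3 : (g * orbitElt A x)⁻¹ * orbitElt A (g • x) = 1 := by
    refine h _ (orbitClass A x).out ?_
    rw [mul_smul, h1, inv_smul_eq_iff, mul_smul, h2]
  exact (inv_mul_eq_one.1 h3).symm

variable {A} in
theorem orbit_conj_mem_stabilizer (g : A) (x : X) :
    (orbitElt A (g • x))⁻¹ * g * orbitElt A x ∈
      MulAction.stabilizer A (orbitClass A x).out := by
  rw [MulAction.mem_stabilizer_iff, mul_smul, mul_smul, orbitElt_smul, inv_smul_eq_iff]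
  conv_rhs => rw [← orbitClass_smul g x]
  rw [orbitElt_smul]

end orbits

/-! ### The quotient graph of groups of an action -/

namespace GraphOfGroups

variable {V E : Type*} {G : V → Type*} [∀ v, Group (G v)] {C : E → Type*} [∀ e, Group (C e)]
  (Y : GraphOfGroups G C) (T : Set E) (X : Type*) [∀ v, MulAction (G v) X]
  [∀ e, MulAction (C e) X]

/-- The vertices of the quotient graph. -/
abbrev OrbitVertex (G : V → Type*) [∀ v, Group (G v)] (X : Type*) [∀ v, MulAction (G v) X] :
    Type _ := Σ v, MulAction.orbitRel.Quotient (G v) X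

/-- The edges of the quotient graph. -/
abbrev OrbitEdge (C : E → Type*) [∀ e, Group (C e)] (X : Type*) [∀ e, MulAction (C e) X] :
    Type _ := Σ e, MulAction.orbitRel.Quotient (C e) X

/-- The vertex groups of the quotient graph of groups. -/
abbrev OrbitGroup (G : V → Type*) [∀ v, Group (G v)] (X : Type*) [∀ v, MulAction (G v) X]
    (ω : OrbitVertex G X) : Type _ := MulAction.stabilizer (G ω.1) ω.2.out

section local_cocycle

variable {X} (D : Set (OrbitEdge C X))

/-- The free product of the vertex stabilizers and of a free group. -/
abbrev OrbitProduct (G : V → Type*) [∀ v, Group (G v)] [∀ v, MulAction (G v) X]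
    (D : Set (OrbitEdge C X)) : Type _ :=
  Monoid.Coprod (Monoid.CoprodI (OrbitGroup G X)) (FreeGroup D)

open Classical in
/-- The embedding of a vertex stabilizer in the free product, extended by `1`. -/
noncomputable def orbitIncl (v : V) (q : MulAction.orbitRel.Quotient (G v) X) (g : G v) :
    OrbitProduct G D :=
  if h : g ∈ MulAction.stabilizer (G v) q.out then
    Monoid.Coprod.inl (Monoid.CoprodI.of (i := (⟨v, q⟩ : OrbitVertex G X)) ⟨g, h⟩) else 1

theorem orbitIncl_mul (v : V) (q : MulAction.orbitRel.Quotient (G v) X) {g h : G v}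
    (hg : g ∈ MulAction.stabilizer (G v) q.out) (hh : h ∈ MulAction.stabilizer (G v) q.out) :
    orbitIncl D v q (g * h) = orbitIncl D v q g * orbitIncl D v q h := by
  unfold orbitIncl
  rw [dif_pos hg, dif_pos hh, dif_pos (mul_mem hg hh), ← map_mul, ← map_mul]
  rfl

theorem orbitIncl_one (v : V) (q : MulAction.orbitRel.Quotient (G v) X) :
    orbitIncl D v q 1 = 1 := by
  have := orbitIncl_mul D v q (one_mem _) (one_mem _)
  rw [mul_one] at this
  exact left_eq_mul.1 this

/-- The tautological cocycle on a vertex group. -/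
noncomputable def orbitCocycle (v : V) (g : G v) (x : X) : OrbitProduct G D :=
  orbitIncl D v (orbitClass (G v) x) ((orbitElt (G v) (g • x))⁻¹ * g * orbitElt (G v) x)

theorem orbitCocycle_mul (v : V) (g h : G v) (x : X) :
    orbitCocycle D v (g * h) x = orbitCocycle D v g (h • x) * orbitCocycle D v h x := by
  unfold orbitCocycle
  have h1 := orbit_conj_mem_stabilizer g (h • x)
  rw [orbitClass_smul] at h1 ⊢
  rw [← orbitIncl_mul D v _ h1 (orbit_conj_mem_stabilizer h x), mul_smul]
  congr 1; group

theorem orbitCocycle_one (v : V) (x : X) : orbitCocycle D v (1 : G v) x = 1 := by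
  simpa using orbitCocycle_mul D v (1 : G v) 1 x

end local_cocycle

variable {X} [MulAction (Y.FundamentalGroup T) X]

/-- The initial vertex of an edge of the quotient graph. -/
noncomputable def orbitSrc (ε : OrbitEdge C X) : OrbitVertex G X :=
  -- Edge groups act through the target vertex group; the stable letter intertwines this with the
  -- action through the source.
  ⟨Y.src ε.1, orbitClass _ (Y.edgeElt T ε.1 • ε.2.out)⟩

/-- The terminal vertex of an edge of the quotient graph. -/
noncomputable def orbitTgt (ε : OrbitEdge C X) : OrbitVertex G X :=
  ⟨Y.tgt ε.1, orbitClass _ ε.2.out⟩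

variable (hG : ∀ v (g : G v) (x : X), Y.vertexHom T v g • x = g • x)
  (hC : ∀ e (c : C e) (x : X), Y.tgtHom e c • x = c • x)

include hG hC in
theorem edgeElt_smul_smul (e : E) (c : C e) (x : X) :
    Y.edgeElt T e • c • x = Y.srcHom e c • Y.edgeElt T e • x := by
  rw [← hC, ← hG, ← hG, ← mul_smul, ← mul_smul, edgeElt_mul]

include hG hC in
theorem orbitSrc_class (e : E) (x : X) :
    Y.orbitSrc T (⟨e, orbitClass (C e) x⟩ : OrbitEdge C X) =
      ⟨Y.src e, orbitClass _ (Y.edgeElt T e • x)⟩ := by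
  have h := orbitElt_smul (C e) x
  conv_rhs => rw [← h, Y.edgeElt_smul_smul T hG hC, orbitClass_smul]
  rfl

include hC in
theorem orbitTgt_class (e : E) (x : X) :
    Y.orbitTgt (⟨e, orbitClass (C e) x⟩ : OrbitEdge C X) = ⟨Y.tgt e, orbitClass _ x⟩ := by
  have h := orbitElt_smul (C e) x
  conv_rhs => rw [← h, ← hC, orbitClass_smul]
  rfl

variable {T}

-- Edges of `T` act trivially, so they join the classes of a fixed point `x` at all vertices. Each
-- generator of the fundamental group then keeps `x` in its component, and transitivity concludes.
include hG hC in
theorem orbitGraph_connected (hT : Y.IsSpanningTree T) [MulAction.IsPretransitive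
    (Y.FundamentalGroup T) X] (v w : V) (x y : X) :
    Relation.EqvGen (fun a b => ∃ ε, Y.orbitSrc T ε = a ∧ Y.orbitTgt ε = b)
      (⟨v, orbitClass (G v) x⟩ : OrbitVertex G X) ⟨w, orbitClass (G w) y⟩ := by
  set R := Relation.EqvGen (fun (a b : OrbitVertex G X) =>
    ∃ ε, Y.orbitSrc T ε = a ∧ Y.orbitTgt ε = b) with hR
  have hedge : ∀ e x, R ⟨Y.src e, orbitClass _ (Y.edgeElt T e • x)⟩ ⟨Y.tgt e, orbitClass _ x⟩ :=
    fun e x => Relation.EqvGen.rel _ _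
      ⟨⟨e, orbitClass _ x⟩, Y.orbitSrc_class T hG hC e x, Y.orbitTgt_class hC e x⟩
  have hjoin : ∀ x v w, R ⟨v, orbitClass (G v) x⟩ ⟨w, orbitClass (G w) x⟩ := by
    intro x v w
    have h := hT.2.1 v w
    induction h with
    | rel u v h =>
      obtain ⟨e, he, rfl, rfl⟩ := h
      have := hedge e x
      rwa [Y.edgeElt_eq_one T he, one_smul] at this
    | refl => exact Relation.EqvGen.refl _
    | symm _ _ _ ih => exact Relation.EqvGen.symm _ _ ih
    | trans _ _ _ _ _ h1 h2 => exact Relation.EqvGen.trans _ _ _ h1 h2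
  have hmove : ∀ (g : Y.FundamentalGroup T) x v,
      R ⟨v, orbitClass (G v) (g • x)⟩ ⟨v, orbitClass (G v) x⟩ := by
    intro g
    induction g using Y.fund_induction with
    | one => intro x v; rw [one_smul]; exact Relation.EqvGen.refl _
    | vertex w g =>
      intro x v
      rw [hG]
      refine Relation.EqvGen.trans _ _ _ (hjoin _ v w) ?_
      rw [orbitClass_smul]
      exact hjoin _ w v
    | edge e =>
      intro x v
      exact Relation.EqvGen.trans _ _ _ (hjoin _ v _)
        (Relation.EqvGen.trans _ _ _ (hedge e x) (hjoin _ _ v))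
    | mul a b ha hb =>
      intro x v
      rw [mul_smul]
      exact Relation.EqvGen.trans _ _ _ (ha _ v) (hb x v)
    | inv a ha =>
      intro x v
      have := Relation.EqvGen.symm _ _ (ha (a⁻¹ • x) v)
      rwa [smul_inv_smul] at this
  obtain ⟨g, rfl⟩ := MulAction.exists_smul_eq (Y.FundamentalGroup T) y x
  exact Relation.EqvGen.trans _ _ _ (hmove g y v) (hjoin y v w)

end GraphOfGroups

/-! ### The cocycle on edges and the structure of point stabilizers -/

namespace GraphOfGroups

variable {V E : Type*} {G : V → Type*} [∀ v, Group (G v)] {C : E → Type*} [∀ e, Group (C e)]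
  (Y : GraphOfGroups G C) {T : Set E} {X : Type*} [∀ v, MulAction (G v) X]
  [∀ e, MulAction (C e) X] [MulAction (Y.FundamentalGroup T) X]

section edge_cocycle

variable (D : Set (OrbitEdge C X))

open Classical in
/-- The free generators, extended by `1`. -/
noncomputable def orbitFree (ε : OrbitEdge C X) : OrbitProduct G D :=
  if h : ε ∈ D then Monoid.Coprod.inr (FreeGroup.of ⟨ε, h⟩) else 1

variable (T) in
/-- The values on the edges of the cocycle which extends `orbitCocycle`. -/
noncomputable def orbitEdgeCocycle (e : E) (x : X) : OrbitProduct G D :=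
  orbitCocycle D (Y.src e) (Y.srcHom e (orbitElt (C e) x))
      (Y.edgeElt T e • (orbitClass (C e) x).out) *
    orbitFree D ⟨e, orbitClass (C e) x⟩ *
    (orbitCocycle D (Y.tgt e) (Y.tgtHom e (orbitElt (C e) x)) (orbitClass (C e) x).out)⁻¹

variable (hG : ∀ v (g : G v) (x : X), Y.vertexHom T v g • x = g • x)
  (hC : ∀ e (c : C e) (x : X), Y.tgtHom e c • x = c • x)
  (hfree : ∀ e (c : C e) (x : X), c • x = x → c = 1)

-- The edge cocycle is prescribed at representatives and transported along the orbits of `C e`.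
-- Freeness makes this transport equivariant, with no condition from stabilizers.
include hG hC hfree in
theorem orbitEdgeCocycle_compat (e : E) (c : C e) (x : X) :
    Y.orbitEdgeCocycle T D e (c • x) * orbitCocycle D _ (Y.tgtHom e c) x =
      orbitCocycle D _ (Y.srcHom e c) (Y.edgeElt T e • x) * Y.orbitEdgeCocycle T D e x := by
  unfold orbitEdgeCocycle
  rw [orbitClass_smul, orbitElt_smul_of_free (hfree e), map_mul, map_mul, orbitCocycle_mul,
    orbitCocycle_mul, hC, orbitElt_smul, ← Y.edgeElt_smul_smul T hG hC, orbitElt_smul]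
  group

theorem orbitEdgeCocycle_out (e : E) (q : MulAction.orbitRel.Quotient (C e) X) :
    Y.orbitEdgeCocycle T D e q.out = orbitFree D ⟨e, q⟩ := by
  unfold orbitEdgeCocycle
  rw [orbitElt_out, orbitClass_out, map_one, map_one, orbitCocycle_one, orbitCocycle_one]
  simp

end edge_cocycle

variable (hG : ∀ v (g : G v) (x : X), Y.vertexHom T v g • x = g • x)
  (hC : ∀ e (c : C e) (x : X), Y.tgtHom e c • x = c • x)
  (hfree : ∀ e (c : C e) (x : X), c • x = x → c = 1)

variable (T) in
/-- The element of the fundamental group carried by an edge of the quotient graph. -/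
noncomputable def orbitEdgeElt (ε : OrbitEdge C X) : Y.FundamentalGroup T :=
  (Y.vertexHom T _ (orbitElt (G (Y.src ε.1)) (Y.edgeElt T ε.1 • ε.2.out)))⁻¹ *
    Y.edgeElt T ε.1 * Y.vertexHom T _ (orbitElt (G (Y.tgt ε.1)) ε.2.out)

include hG in
theorem orbitEdgeElt_smul (ε : OrbitEdge C X) :
    Y.orbitEdgeElt T ε • (Y.orbitTgt ε).2.out = (Y.orbitSrc T ε).2.out := by
  unfold orbitEdgeElt orbitTgt orbitSrc
  rw [mul_smul, mul_smul, hG, orbitElt_smul, inv_smul_eq_iff, hG, orbitElt_smul]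

omit [∀ e, MulAction (C e) X] in
include hG in
theorem vertexHom_smul_out {ω : OrbitVertex G X} (s : OrbitGroup G X ω) :
    Y.vertexHom T ω.1 s • ω.2.out = ω.2.out := by
  rw [hG]; exact s.2

variable {D : Set (OrbitEdge C X)} (p : OrbitVertex G X → Y.FundamentalGroup T)

/-- The homomorphism from the free product to the fundamental group. -/
noncomputable def orbitProductHom : OrbitProduct G D →* Y.FundamentalGroup T :=
  Monoid.Coprod.lift
    (Monoid.CoprodI.lift fun ω => (MulAut.conj (p ω)⁻¹).toMonoidHom.comp
      ((Y.vertexHom T ω.1).comp (MulAction.stabilizer (G ω.1) ω.2.out).subtype))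
    (FreeGroup.lift fun ε : D =>
      (p (Y.orbitSrc T ε.1))⁻¹ * Y.orbitEdgeElt T ε.1 * p (Y.orbitTgt ε.1))

theorem orbitProductHom_of (ω : OrbitVertex G X) (s : OrbitGroup G X ω) :
    Y.orbitProductHom (D := D) p (Monoid.Coprod.inl (Monoid.CoprodI.of s)) =
      (p ω)⁻¹ * Y.vertexHom T ω.1 s * p ω := by
  simp [orbitProductHom]

theorem orbitProductHom_free (ε : D) :
    Y.orbitProductHom (D := D) p (Monoid.Coprod.inr (FreeGroup.of ε)) =
      (p (Y.orbitSrc T ε.1))⁻¹ * Y.orbitEdgeElt T ε.1 * p (Y.orbitTgt ε.1) := by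
  simp [orbitProductHom]

theorem orbitProductHom_orbitFree
    (hp : ∀ ε ∉ D, p (Y.orbitSrc T ε) = Y.orbitEdgeElt T ε * p (Y.orbitTgt ε))
    (ε : OrbitEdge C X) :
    Y.orbitProductHom (D := D) p (orbitFree D ε) =
      (p (Y.orbitSrc T ε))⁻¹ * Y.orbitEdgeElt T ε * p (Y.orbitTgt ε) := by
  unfold orbitFree
  split_ifs with h
  · exact Y.orbitProductHom_free p ⟨ε, h⟩
  · rw [map_one, mul_assoc, ← hp ε h, inv_mul_cancel]

/-- Mapped to the fundamental group, the tautological cocycle becomes cohomologous to the cocycle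
`(g, x) ↦ g`. The same holds on edges, and this yields `Ψ ∘ Φ = id` below. -/
theorem orbitProductHom_orbitCocycle (v : V) (g : G v) (x : X) :
    Y.orbitProductHom (D := D) p (orbitCocycle D v g x) =
      (Y.vertexHom T v (orbitElt (G v) (g • x)) * p ⟨v, orbitClass _ (g • x)⟩)⁻¹ *
        Y.vertexHom T v g * (Y.vertexHom T v (orbitElt (G v) x) * p ⟨v, orbitClass _ x⟩) := by
  unfold orbitCocycle orbitIncl
  rw [dif_pos (orbit_conj_mem_stabilizer g x), orbitProductHom_of, orbitClass_smul]
  simp only [map_mul, map_inv]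
  group

include hG hC in
theorem orbitProductHom_orbitEdgeCocycle
    (hp : ∀ ε ∉ D, p (Y.orbitSrc T ε) = Y.orbitEdgeElt T ε * p (Y.orbitTgt ε)) (e : E) (x : X) :
    Y.orbitProductHom (D := D) p (Y.orbitEdgeCocycle T D e x) =
      (Y.vertexHom T _ (orbitElt (G (Y.src e)) (Y.edgeElt T e • x)) *
        p ⟨Y.src e, orbitClass _ (Y.edgeElt T e • x)⟩)⁻¹ * Y.edgeElt T e *
        (Y.vertexHom T _ (orbitElt (G (Y.tgt e)) x) * p ⟨Y.tgt e, orbitClass _ x⟩) := by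
  unfold orbitEdgeCocycle
  rw [map_mul, map_mul, map_inv, orbitProductHom_orbitCocycle, orbitProductHom_orbitCocycle,
    Y.orbitProductHom_orbitFree p hp]
  rw [← Y.edgeElt_smul_smul T hG hC, hC, orbitElt_smul]
  unfold orbitEdgeElt orbitSrc orbitTgt
  have h := Y.edgeElt_mul T e (orbitElt (C e) x)
  simp only [mul_inv_rev, inv_inv, mul_assoc, mul_inv_cancel_left]
  rw [← mul_assoc (Y.vertexHom T (Y.src e) (Y.srcHom e (orbitElt (C e) x))), ← h, mul_assoc,
    mul_inv_cancel_left]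

include hG in
theorem orbitProductHom_mem (x₀ : X) (hp : ∀ ω, p ω • x₀ = ω.2.out) (y : OrbitProduct G D) :
    Y.orbitProductHom (D := D) p y ∈ MulAction.stabilizer (Y.FundamentalGroup T) x₀ := by
  suffices h : (MulAction.stabilizer (Y.FundamentalGroup T) x₀).comap
      (Y.orbitProductHom (D := D) p) = ⊤ from (h ▸ Subgroup.mem_top y :)
  rw [eq_top_iff, ← Monoid.Coprod.range_inl_sup_range_inr]
  refine sup_le ?_ ?_
  · rintro _ ⟨y, rfl⟩
    induction y using Monoid.CoprodI.induction_on with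
    | one => rw [map_one]; exact one_mem _
    | of ω s =>
      rw [Subgroup.mem_comap, orbitProductHom_of, MulAction.mem_stabilizer_iff, mul_smul,
        mul_smul, hp, Y.vertexHom_smul_out hG, ← hp, inv_smul_smul]
    | mul a b ha hb => rw [map_mul]; exact mul_mem ha hb
  · rintro _ ⟨y, rfl⟩
    induction y using FreeGroup.induction_on with
    | C1 => rw [map_one]; exact one_mem _
    | of ε =>
      rw [Subgroup.mem_comap, orbitProductHom_free, MulAction.mem_stabilizer_iff, mul_smul,
        mul_smul, hp, Y.orbitEdgeElt_smul hG, ← hp, inv_smul_smul]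
    | inv_of e he => rw [map_inv]; exact inv_mem he
    | mul a b ha hb => rw [map_mul]; exact mul_mem ha hb

include hG hC hfree in
/-- The structure of a point stabilizer when the edge groups act freely: it is the free product
of stabilizers in vertex groups, one for each orbit, and of a free group on the edges outside
a spanning tree of the quotient graph. -/
theorem exists_orbitProduct_equiv [Finite E] (hT : Y.IsSpanningTree T)
    [MulAction.IsPretransitive (Y.FundamentalGroup T) X] (x₀ : X) :
    ∃ (ω₀ : OrbitVertex G X) (t : RootedSpanningTree (Y.orbitSrc T (X := X)) Y.orbitTgt ω₀)
      (p : OrbitVertex G X → Y.FundamentalGroup T)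
      (Ψ : OrbitProduct G (X := X) t.edgesᶜ ≃* MulAction.stabilizer (Y.FundamentalGroup T) x₀),
      ∀ ω s, (Ψ (Monoid.Coprod.inl (Monoid.CoprodI.of (i := ω) s)) : Y.FundamentalGroup T) =
        (p ω)⁻¹ * Y.vertexHom T ω.1 s * p ω := by
  obtain ⟨v₀⟩ := hT.1
  set ω₀ : OrbitVertex G X := ⟨v₀, orbitClass _ x₀⟩ with hω₀
  obtain ⟨t⟩ := RootedSpanningTree.nonempty (src := Y.orbitSrc T (X := X)) (tgt := Y.orbitTgt)
    (v₀ := ω₀) (by rintro ⟨v, q⟩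
                   have := Y.orbitGraph_connected hG hC hT v₀ v x₀ q.out
                   rwa [orbitClass_out] at this)
  set D := t.edgesᶜ with hD
  -- Twisting by `k` makes the edge cocycle trivial on `T`, as the relators `t_e = 1` demand.
  obtain ⟨k, hk⟩ := exists_coboundary_of_forest Y.src Y.tgt T.toFinite hT.2.2
    (fun e x => Y.orbitEdgeCocycle T D e x)
  obtain ⟨c, hmul, hvert, hedge⟩ := Y.exists_cocycle T
    (fun v g x => (k v (g • x))⁻¹ * orbitCocycle D v g x * k v x)
    (fun e x => (k (Y.src e) (Y.edgeElt T e • x))⁻¹ * Y.orbitEdgeCocycle T D e x *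
      k (Y.tgt e) x)
    (by
      intro v g h x
      simp only [orbitCocycle_mul, hG, mul_smul]
      group)
    (by
      intro e c x
      have h := Y.orbitEdgeCocycle_compat D hG hC hfree e c x
      have h' := congrArg (fun z => (k (Y.src e) (Y.edgeElt T e • c • x))⁻¹ * z * k (Y.tgt e) x) h
      simp only [hG, hC, Y.edgeElt_smul_smul T hG hC] at h' ⊢
      simpa only [mul_assoc, mul_inv_cancel_left] using h')
    (by
      intro e he x
      have := congrFun (hk e he) x
      simp only [Pi.mul_apply] at this
      rw [Y.edgeElt_eq_one T he, one_smul, mul_assoc, ← this, inv_mul_cancel])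
  have hc1 : ∀ x, c 1 x = 1 := fun x => by simpa using hmul 1 1 x
  have hinv : ∀ g x, c g⁻¹ (g • x) = (c g x)⁻¹ := fun g x => by
    rw [eq_inv_iff_mul_eq_one, ← hmul, inv_mul_cancel, hc1]
  -- `p ω` moves `x₀` to the representative of `ω` along the tree `t`, so the edges of `t`
  -- contribute no free generator. The value at the root makes `Ψ ∘ Φ` the identity rather than a
  -- conjugation.
  obtain ⟨p, hp₀, hp⟩ := t.exists_coboundary (Y.orbitEdgeElt T)
    (Y.vertexHom T v₀ (orbitElt (G v₀) x₀))⁻¹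
  have hpx : ∀ ω, p ω • x₀ = ω.2.out := by
    refine t.induction ?_ ?_
    · rw [hp₀, inv_smul_eq_iff, hG]
      exact (orbitElt_smul _ _).symm
    · intro ε hε
      rw [hp ε hε, mul_smul, ← Y.orbitEdgeElt_smul hG, smul_left_cancel_iff]
  have hcelt : ∀ v x, c (Y.vertexHom T v (orbitElt (G v) x)) (orbitClass (G v) x).out =
      (k v x)⁻¹ * k v (orbitClass (G v) x).out := by
    intro v x
    rw [hvert, orbitElt_smul]
    unfold orbitCocycle
    rw [orbitElt_smul, orbitElt_out, orbitClass_out, mul_one, inv_mul_cancel, orbitIncl_one,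
      mul_one]
  have hcε : ∀ ε : OrbitEdge C X, c (Y.orbitEdgeElt T ε) (Y.orbitTgt ε).2.out =
      (k (Y.orbitSrc T ε).1 (Y.orbitSrc T ε).2.out)⁻¹ * orbitFree D ε *
        k (Y.orbitTgt ε).1 (Y.orbitTgt ε).2.out := by
    rintro ⟨e, q⟩
    have h1 := hinv (Y.vertexHom T _ (orbitElt (G (Y.src e)) (Y.edgeElt T e • q.out)))
      (orbitClass (G (Y.src e)) (Y.edgeElt T e • q.out)).out
    rw [hG, orbitElt_smul, hcelt] at h1
    change c ((Y.vertexHom T _ (orbitElt (G (Y.src e)) (Y.edgeElt T e • q.out)))⁻¹ *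
      Y.edgeElt T e * Y.vertexHom T _ (orbitElt (G (Y.tgt e)) q.out))
        (orbitClass (G (Y.tgt e)) q.out).out =
      (k (Y.src e) (orbitClass (G (Y.src e)) (Y.edgeElt T e • q.out)).out)⁻¹ *
        orbitFree D ⟨e, q⟩ * k (Y.tgt e) (orbitClass (G (Y.tgt e)) q.out).out
    rw [hmul, hcelt, hG, orbitElt_smul, hmul, h1, hedge, orbitEdgeCocycle_out]
    group
  have hcs : ∀ (ω : OrbitVertex G X) (s : OrbitGroup G X ω),
      c (Y.vertexHom T ω.1 s) ω.2.out = (k ω.1 ω.2.out)⁻¹ *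
        Monoid.Coprod.inl (Monoid.CoprodI.of s) * k ω.1 ω.2.out := by
    rintro ⟨v, q⟩ ⟨s, hs⟩
    have hs' : s • q.out = q.out := hs
    rw [hvert]
    simp only [hs']
    congr 2
    unfold orbitCocycle
    rw [hs', orbitElt_out, orbitClass_out, inv_one, one_mul, mul_one]
    exact dif_pos hs
  have hcp : ∀ ω, c (p ω) x₀ = (k ω.1 ω.2.out)⁻¹ * k v₀ x₀ := by
    refine t.induction ?_ ?_
    · rw [hp₀]
      have h1 := hinv (Y.vertexHom T v₀ (orbitElt (G v₀) x₀)) (orbitClass (G v₀) x₀).out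
      rw [hG, orbitElt_smul, hcelt] at h1
      rw [h1, mul_inv_rev, inv_inv]
    · intro ε hε
      rw [hp ε hε, hmul, hpx, hcε]
      have : orbitFree (G := G) D ε = 1 := dif_neg (by simpa [hD] using hε)
      rw [this, mul_one, mul_assoc, mul_right_inj]
      exact eq_inv_mul_iff_mul_eq.symm
  let Φ : MulAction.stabilizer (Y.FundamentalGroup T) x₀ →* OrbitProduct G D :=
    MonoidHom.mk' (fun n => k v₀ x₀ * c n.1 x₀ * (k v₀ x₀)⁻¹) (by
      rintro ⟨a, ha⟩ ⟨b, hb⟩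
      have hb' : b • x₀ = x₀ := hb
      simp only [Subgroup.coe_mul, hmul, hb']
      group)
  let Ψ : OrbitProduct G D →* MulAction.stabilizer (Y.FundamentalGroup T) x₀ :=
    (Y.orbitProductHom (D := D) p).codRestrict _ (Y.orbitProductHom_mem hG p x₀ hpx)
  have hΨ : ∀ y, (Ψ y : Y.FundamentalGroup T) = Y.orbitProductHom (D := D) p y := fun _ => rfl
  have hΦ : ∀ n, Φ n = k v₀ x₀ * c n.1 x₀ * (k v₀ x₀)⁻¹ := fun _ => rfl
  have hpinv : ∀ ω, c (p ω)⁻¹ ω.2.out = (c (p ω) x₀)⁻¹ := fun ω => by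
    rw [← hpx, hinv]
  have hΦΨ : Φ.comp Ψ = MonoidHom.id _ := by
    ext y
    · simp only [MonoidHom.comp_apply, hΦ, hΨ, orbitProductHom_of, hmul, hpx,
        Y.vertexHom_smul_out hG, hcs, hpinv, hcp, MonoidHom.id_apply]
      group
    · simp only [MonoidHom.comp_apply, hΦ, hΨ, orbitProductHom_free, hmul, hpx,
        Y.orbitEdgeElt_smul hG, hcε, hpinv, hcp, MonoidHom.id_apply]
      have : orbitFree (G := G) D y.1 = Monoid.Coprod.inr (FreeGroup.of y) := dif_pos y.2
      rw [this, orbitSrc, orbitTgt]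
      group
  have hp' : ∀ ε ∉ D, p (Y.orbitSrc T ε) = Y.orbitEdgeElt T ε * p (Y.orbitTgt ε) :=
    fun ε hε => hp ε (by simpa [hD] using hε)
  -- `j` is the cochain relating the image of `c` to the identity cocycle. It does not depend on the
  -- vertex, because `k` was chosen to trivialize `T`.
  let j : V → X → Y.FundamentalGroup T := fun v x =>
    Y.vertexHom T v (orbitElt (G v) x) * p ⟨v, orbitClass _ x⟩ *
      Y.orbitProductHom (D := D) p (k v x)
  have hj : ∀ x u v, j u x = j v x := by
    intro x u v
    have h := hT.2.1 u v
    induction h with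
    | rel u v h =>
      obtain ⟨e, he, rfl, rfl⟩ := h
      have h1 := congrFun (hk e he) x
      simp only [Pi.mul_apply] at h1
      simp only [j]
      rw [h1, map_mul, Y.orbitProductHom_orbitEdgeCocycle hG hC p hp', Y.edgeElt_eq_one T he,
        one_smul]
      group
    | refl => rfl
    | symm _ _ _ ih => exact ih.symm
    | trans _ _ _ _ _ h1 h2 => exact h1.trans h2
  have hjc : ∀ g x, Y.orbitProductHom (D := D) p (c g x) = (j v₀ (g • x))⁻¹ * g * j v₀ x := by
    intro g
    induction g using Y.fund_induction with
    | one => intro x; simp [hc1]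
    | vertex v g =>
      intro x
      rw [hvert, hj _ v₀ v, hj _ v₀ v, map_mul, map_mul, map_inv, orbitProductHom_orbitCocycle, hG]
      simp only [j]
      group
    | edge e =>
      intro x
      rw [hedge, hj _ v₀ (Y.src e), hj _ v₀ (Y.tgt e), map_mul, map_mul, map_inv,
        Y.orbitProductHom_orbitEdgeCocycle hG hC p hp']
      simp only [j]
      group
    | mul a b ha hb =>
      intro x
      rw [hmul, map_mul, ha, hb, mul_smul]
      group
    | inv a ha =>
      intro x
      have h1 := hinv a (a⁻¹ • x)
      rw [smul_inv_smul] at h1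
      rw [h1, map_inv, ha, smul_inv_smul]
      group
  have hΨΦ : Ψ.comp Φ = MonoidHom.id _ := by
    refine MonoidHom.ext fun ⟨n, hn⟩ => Subtype.ext ?_
    have hn' : n • x₀ = x₀ := hn
    rw [MonoidHom.comp_apply, hΨ, hΦ]
    simp only [map_mul, map_inv, hjc, hn', MonoidHom.id_apply]
    simp only [j]
    rw [hω₀] at hp₀
    rw [hp₀]
    group
  exact ⟨ω₀, t, p, MonoidHom.toMulEquiv Ψ Φ hΦΨ hΨΦ, fun ω s => Y.orbitProductHom_of p ω s⟩

end GraphOfGroups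

/-! ### Free products of groups -/

open Monoid in
theorem FreelyIndecomposable.subsingleton_or {A P Q : Type*} [Group A] [Group P] [Group Q]
    (hA : FreelyIndecomposable A) (f : Coprod P Q ≃* A) : Subsingleton P ∨ Subsingleton Q := by
  set fP : P →* A := f.toMonoidHom.comp Coprod.inl with hfP
  set fQ : Q →* A := f.toMonoidHom.comp Coprod.inr with hfQ
  have iP : Function.Injective fP := f.injective.comp Coprod.inl_injective
  have iQ : Function.Injective fQ := f.injective.comp Coprod.inr_injective
  let eP := MonoidHom.ofInjective iP
  let eQ := MonoidHom.ofInjective iQ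
  have h : (Coprod.lift fP.range.subtype fQ.range.subtype).comp
      (MulEquiv.coprodCongr eP eQ).toMonoidHom = f.toMonoidHom := by
    ext x <;> rfl
  have hb : Function.Bijective (Coprod.lift fP.range.subtype fQ.range.subtype) := by
    have h1 : Function.Bijective ((Coprod.lift fP.range.subtype fQ.range.subtype) ∘
        (MulEquiv.coprodCongr eP eQ)) := by
      have := f.bijective
      have h2 : ⇑f = (Coprod.lift fP.range.subtype fQ.range.subtype) ∘
        (MulEquiv.coprodCongr eP eQ) := by
        ext x; exact (DFunLike.congr_fun h x).symm
      rwa [h2] at this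
    exact (Function.Bijective.of_comp_iff _ (MulEquiv.bijective _)).1 h1
  refine (hA.2 _ _ hb).imp (fun h0 => ?_) (fun h0 => ?_)
  · rw [MonoidHom.range_eq_bot_iff] at h0
    exact ⟨fun a b => iP (by simp [h0])⟩
  · rw [MonoidHom.range_eq_bot_iff] at h0
    exact ⟨fun a b => iQ (by simp [h0])⟩

theorem FreelyIndecomposable.of_mulEquiv {A B : Type*} [Group A] [Group B]
    (hA : FreelyIndecomposable A) (e : A ≃* B) : FreelyIndecomposable B := by
  refine ⟨have := hA.1; e.symm.toEquiv.nontrivial, fun P Q h => ?_⟩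
  refine (hA.subsingleton_or ((MulEquiv.ofBijective _ h).trans e.symm)).imp ?_ ?_ <;>
    exact fun h => Subgroup.eq_bot_of_subsingleton _

/-- All finite index subgroups are freely indecomposable. -/
def HereditarilyIndecomposable (A : Type*) [Group A] : Prop :=
  ∀ L : Subgroup A, L.FiniteIndex → FreelyIndecomposable L

namespace HereditarilyIndecomposable

variable {A B : Type*} [Group A] [Group B]

theorem subgroup (hA : HereditarilyIndecomposable A) (L : Subgroup A) (hL : L.FiniteIndex) :
    HereditarilyIndecomposable L := by
  intro M hM
  refine (hA (M.map L.subtype) ⟨?_⟩).of_mulEquiv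
    (M.equivMapOfInjective L.subtype L.subtype_injective).symm
  rw [Subgroup.index_map_subtype]
  exact mul_ne_zero hM.index_ne_zero hL.index_ne_zero

theorem of_mulEquiv (hA : HereditarilyIndecomposable A) (e : A ≃* B) :
    HereditarilyIndecomposable B := by
  intro L hL
  have h : (L.comap e.toMonoidHom).FiniteIndex := by
    constructor
    rw [Subgroup.index_comap_of_surjective _ e.surjective]
    exact hL.index_ne_zero
  exact (hA _ h).of_mulEquiv (e.subgroupMap _ |>.trans (MulEquiv.subgroupCongr
    (Subgroup.map_comap_eq_self_of_surjective e.surjective L)))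

theorem freelyIndecomposable (hA : HereditarilyIndecomposable A) : FreelyIndecomposable A :=
  (hA ⊤ inferInstance).of_mulEquiv Subgroup.topEquiv

theorem infinite (hA : HereditarilyIndecomposable A) : Infinite A := by
  by_contra h
  rw [not_infinite_iff_finite] at h
  obtain ⟨h1, -⟩ := hA ⊥ inferInstance
  exact not_subsingleton (⊥ : Subgroup A) inferInstance

end HereditarilyIndecomposable

namespace IsInternalFreeProduct

variable {H ι : Type*} [Group H] {K : ι → Subgroup H}

/-- The isomorphism with the external free product. -/
noncomputable def equiv (hK : IsInternalFreeProduct K) : (Monoid.CoprodI fun i => K i) ≃* H :=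
  MulEquiv.ofBijective _ hK

@[simp] theorem equiv_of (hK : IsInternalFreeProduct K) {i : ι} (k : K i) :
    hK.equiv (Monoid.CoprodI.of (M := fun i => K i) k) = k :=
  Monoid.CoprodI.lift_of _ _

@[simp] theorem equiv_symm_coe (hK : IsInternalFreeProduct K) {i : ι} (k : K i) :
    hK.equiv.symm (k : H) = Monoid.CoprodI.of (M := fun i => K i) k := by
  rw [MulEquiv.symm_apply_eq, equiv_of]

theorem iSup_eq_top (hK : IsInternalFreeProduct K) : ⨆ i, K i = ⊤ := by
  have h := hK.2
  rw [← MonoidHom.range_eq_top, Monoid.CoprodI.range_eq_iSup] at h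
  simpa using h

end IsInternalFreeProduct

-- A homomorphism inverting the canonical map on each factor is a left inverse, which gives
-- injectivity; only generation remains.
open Monoid in
theorem isInternalFreeProduct_of_retraction {H ι : Type*} [Group H] {K : ι → Subgroup H}
    (r : H →* CoprodI fun i => K i) (hr : ∀ i (k : K i), r k = CoprodI.of (M := fun i => K i) k)
    (hK : ⨆ i, K i = ⊤) : IsInternalFreeProduct K := by
  constructor
  · have : r.comp (CoprodI.lift fun i => (K i).subtype) = MonoidHom.id _ := by
      ext i k; simp [hr]
    exact Function.LeftInverse.injective (g := r) fun x => DFunLike.congr_fun this x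
  · rw [← MonoidHom.range_eq_top, CoprodI.range_eq_iSup]
    simpa using hK

open Monoid in
theorem hasFSplitting_of_internal {H ι : Type*} [Group H] [Finite ι] {K : ι → Subgroup H}
    (hK : IsInternalFreeProduct K) (h : ∀ i, HereditarilyIndecomposable (K i)) :
    HasFSplitting H (Nat.card ι) := by
  let e := (Finite.equivFin ι).symm
  have hmem : ∀ j, ∀ k ∈ K j, k ∈ K (e (e.symm j)) := fun j k hk => by
    rwa [e.apply_symm_apply]
  let r₁ : (CoprodI fun i => K i) →* CoprodI fun i => K (e i) := CoprodI.lift fun j =>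
    (CoprodI.of (M := fun i => K (e i)) (i := e.symm j)).comp (Subgroup.inclusion (hmem j))
  have key : ∀ (i i' : Fin (Nat.card ι)) (_ : i' = i) (k : H) (hk : k ∈ K (e i))
      (hk' : k ∈ K (e i')), CoprodI.of (M := fun i => K (e i)) (i := i') ⟨k, hk'⟩ =
      CoprodI.of (M := fun i => K (e i)) (i := i) ⟨k, hk⟩ := by
    rintro i _ rfl k hk hk'; rfl
  refine ⟨fun i => K (e i), isInternalFreeProduct_of_retraction
    (r₁.comp hK.equiv.symm.toMonoidHom) ?_ ?_, fun i => h (e i)⟩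
  · intro i k
    change r₁ (hK.equiv.symm (k : H)) = _
    rw [hK.equiv_symm_coe]
    simp only [r₁, CoprodI.lift_of, MonoidHom.comp_apply]
    exact key _ _ (e.symm_apply_apply i) k k.2 _
  · rw [e.surjective.iSup_comp (g := K), hK.iSup_eq_top]

open Monoid in
theorem hasFSplitting_of_coprodI {H ι : Type*} [Group H] [Finite ι] {A : ι → Type*}
    [∀ i, Group (A i)] (f : CoprodI A ≃* H) (h : ∀ i, HereditarilyIndecomposable (A i)) :
    HasFSplitting H (Nat.card ι) := by
  classical
  have hinj : ∀ i, Function.Injective (f.toMonoidHom.comp (CoprodI.of (M := A) (i := i))) :=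
    fun i => f.injective.comp (CoprodI.of_injective i)
  let K : ι → Subgroup H := fun i => (f.toMonoidHom.comp (CoprodI.of (M := A) (i := i))).range
  let e : ∀ i, A i ≃* K i := fun i => MonoidHom.ofInjective (hinj i)
  refine hasFSplitting_of_internal (K := K) (isInternalFreeProduct_of_retraction
    ((CoprodI.lift fun i => (CoprodI.of (M := fun i => K i)).comp (e i).toMonoidHom).comp
      f.symm.toMonoidHom) ?_ ?_) (fun i => (h i).of_mulEquiv (e i))
  · intro i k
    obtain ⟨a, rfl⟩ := (e i).surjective k
    have : ((e i a : K i) : H) = f (CoprodI.of a) := rfl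
    rw [MonoidHom.comp_apply, this]
    simp
  · have : (f.toMonoidHom.comp (CoprodI.lift fun i => CoprodI.of (M := A) (i := i))).range = ⊤ := by
      rw [MonoidHom.range_eq_top, CoprodI.lift_of']
      exact f.surjective
    rw [← this]
    have h2 := CoprodI.range_eq_iSup (G := A)
      (fun i => f.toMonoidHom.comp (CoprodI.of (M := A) (i := i)))
    rw [← h2]
    refine congrArg MonoidHom.range (CoprodI.ext_hom _ _ fun i => ?_)
    ext; simp

theorem HasFSplitting.of_mulEquiv {H H' : Type*} [Group H] [Group H'] {n : ℕ}
    (h : HasFSplitting H n) (e : H ≃* H') : HasFSplitting H' n := by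
  obtain ⟨K, hK, hi⟩ := h
  simpa using hasFSplitting_of_coprodI (hK.equiv.trans e) hi

open Monoid in
theorem HasFSplitting.coprodI {ι : Type*} [Fintype ι] {S : ι → Type*} [∀ i, Group (S i)]
    {n : ι → ℕ} (h : ∀ i, HasFSplitting (S i) (n i)) :
    HasFSplitting (CoprodI S) (∑ i, n i) := by
  classical
  choose K hK hi using h
  let e : ∀ i, (CoprodI fun j => K i j) ≃* S i := fun i => (hK i).equiv
  have he : ∀ i j (k : K i j), e i (CoprodI.of (M := fun j => K i j) k) = k :=
    fun i j k => (hK i).equiv_of k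
  let f : (CoprodI fun x : Σ i, Fin (n i) => K x.1 x.2) →* CoprodI S :=
    CoprodI.lift fun x => CoprodI.of.comp (K x.1 x.2).subtype
  let g₀ : ∀ i, (CoprodI fun j => K i j) →* CoprodI fun x : Σ i, Fin (n i) => K x.1 x.2 :=
    fun i => CoprodI.lift fun j =>
      CoprodI.of (M := fun x : Σ i, Fin (n i) => K x.1 x.2) (i := ⟨i, j⟩)
  let g : CoprodI S →* CoprodI fun x : Σ i, Fin (n i) => K x.1 x.2 :=
    CoprodI.lift fun i => (g₀ i).comp (e i).symm.toMonoidHom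
  have hg : ∀ i y, g (CoprodI.of (e i y)) = g₀ i y := fun i y => by simp [g]
  have h1 : g.comp f = MonoidHom.id _ := by
    refine CoprodI.ext_hom _ _ fun ⟨i, j⟩ => MonoidHom.ext fun k => ?_
    have : f (CoprodI.of (M := fun x : Σ i, Fin (n i) => K x.1 x.2) (i := ⟨i, j⟩) k) =
        CoprodI.of (e i (CoprodI.of (M := fun j => K i j) k)) := by rw [he]; simp [f]
    change g (f (CoprodI.of (M := fun x : Σ i, Fin (n i) => K x.1 x.2) (i := ⟨i, j⟩) k)) =
      CoprodI.of (M := fun x : Σ i, Fin (n i) => K x.1 x.2) (i := ⟨i, j⟩) k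
    rw [this, hg]
    exact CoprodI.lift_of _ _
  have h2 : f.comp g = MonoidHom.id _ := by
    refine CoprodI.ext_hom _ _ fun i => ?_
    suffices h : (f.comp (g₀ i)) = (CoprodI.of (M := S) (i := i)).comp (e i).toMonoidHom by
      refine MonoidHom.ext fun s => ?_
      obtain ⟨y, rfl⟩ := (e i).surjective s
      have := DFunLike.congr_fun h y
      simpa [hg] using this
    refine CoprodI.ext_hom _ _ fun j => MonoidHom.ext fun k => ?_
    simp [g₀, f, he]
  have := hasFSplitting_of_coprodI (MonoidHom.toMulEquiv f g h1 h2) fun x => hi x.1 x.2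
  simpa using this

open Monoid in
theorem HasFSplitting.coprod {A B : Type*} [Group A] [Group B] {a b : ℕ}
    (hA : HasFSplitting A a) (hB : HasFSplitting B b) : HasFSplitting (Coprod A B) (a + b) := by
  obtain ⟨K, hK, hKi⟩ := hA
  obtain ⟨L, hL, hLi⟩ := hB
  let M : Fin a ⊕ Fin b → Subgroup (Coprod A B) :=
    Sum.elim (fun i => (K i).map Coprod.inl) (fun j => (L j).map Coprod.inr)
  let qK : ∀ i, K i ≃* M (Sum.inl i) := fun i =>
    show K i ≃* (K i).map (Coprod.inl : A →* Coprod A B) from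
      (K i).equivMapOfInjective _ Coprod.inl_injective
  let qL : ∀ i, L i ≃* M (Sum.inr i) := fun i =>
    show L i ≃* (L i).map (Coprod.inr : B →* Coprod A B) from
      (L i).equivMapOfInjective _ Coprod.inr_injective
  let r : Coprod A B →* CoprodI fun x => M x := Coprod.lift
    ((CoprodI.lift fun i => (CoprodI.of (M := fun x => M x)).comp (qK i).toMonoidHom).comp
      hK.equiv.symm.toMonoidHom)
    ((CoprodI.lift fun i => (CoprodI.of (M := fun x => M x)).comp (qL i).toMonoidHom).comp
      hL.equiv.symm.toMonoidHom)
  have hM : IsInternalFreeProduct M := by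
    refine isInternalFreeProduct_of_retraction r ?_ ?_
    · rintro (i | i) k
      · obtain ⟨k, rfl⟩ := (qK i).surjective k
        have : ((qK i k : M _) : Coprod A B) = Coprod.inl (k : A) := rfl
        rw [this]
        simp [r, hK.equiv_symm_coe]
      · obtain ⟨k, rfl⟩ := (qL i).surjective k
        have : ((qL i k : M _) : Coprod A B) = Coprod.inr (k : B) := rfl
        rw [this]
        simp [r, hL.equiv_symm_coe]
    · rw [iSup_sum]
      simp only [M, Sum.elim_inl, Sum.elim_inr]
      rw [← Subgroup.map_iSup, ← Subgroup.map_iSup, hK.iSup_eq_top,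
        hL.iSup_eq_top, ← MonoidHom.range_eq_map,
        ← MonoidHom.range_eq_map, Coprod.range_inl_sup_range_inr]
  have := hasFSplitting_of_internal hM (by
    rintro (i | i)
    · exact HereditarilyIndecomposable.of_mulEquiv (hKi i) (qK i)
    · exact HereditarilyIndecomposable.of_mulEquiv (hLi i) (qL i))
  simpa using this

/-! ### Nilpotent groups are freely indecomposable -/

namespace Monoid.CoprodI

theorem NeWord.length_pos {ι : Type*} {M : ι → Type*} [∀ i, Monoid (M i)] {i j : ι}
    (w : NeWord M i j) : 0 < w.toList.length :=
  List.length_pos_iff.2 w.toList_ne_nil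

/-- If `z` is a non-empty reduced word ending in the factor `j`, and `g ≠ 1` lies in another factor,
then `z * g * z⁻¹` is reduced of length at least 3, so it is not `g`. -/
theorem eq_one_of_mem_center {ι : Type*} {M : ι → Type*} [∀ i, Group (M i)] [Nontrivial ι]
    (hM : ∀ i, Nontrivial (M i)) {z : CoprodI M} (hz : z ∈ Subgroup.center (CoprodI M)) :
    z = 1 := by
  classical
  by_contra hne
  obtain ⟨i, j, w, hw⟩ := NeWord.of_word (Word.equiv z) (by
    intro h
    apply hne
    rw [← Word.equiv.symm_apply_apply z, h]
    rfl)
  have hwz : w.prod = z := by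
    change w.toWord.prod = z
    rw [hw]
    exact Word.equiv.symm_apply_apply z
  obtain ⟨k, hk⟩ := exists_ne j
  have := hM k
  obtain ⟨g, hg⟩ := exists_ne (1 : M k)
  let u : NeWord M i i :=
    NeWord.append (NeWord.append w hk.symm (NeWord.singleton g hg)) hk w.inv
  have hu : u.prod = (NeWord.singleton g hg).prod := by
    simp only [u, NeWord.append_prod, NeWord.inv_prod, hwz, NeWord.prod_singleton]
    rw [mul_inv_eq_iff_eq_mul]
    exact (Subgroup.mem_center_iff.1 hz _).symm
  have h2 : u.toWord = (NeWord.singleton g hg).toWord := Word.equiv.symm.injective hu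
  have h3 : u.toList.length = 1 := congrArg (fun w => w.toList.length) h2
  simp only [u, NeWord.toList, List.length_append, List.length_singleton] at h3
  have := w.length_pos
  omega

end Monoid.CoprodI

/-- A trivial centre would keep the whole upper central series trivial. -/
theorem Group.IsNilpotent.nontrivial_center (A : Type*) [Group A] [Group.IsNilpotent A]
    [Nontrivial A] : Nontrivial (Subgroup.center A) := by
  by_contra h
  rw [not_nontrivial_iff_subsingleton] at h
  have hb : Subgroup.center A = ⊥ := Subgroup.eq_bot_of_subsingleton _
  have h1 : ∀ n, Subgroup.upperCentralSeries A n = ⊥ := by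
    intro n
    induction n with
    | zero => rfl
    | succ n ih =>
      rw [eq_bot_iff, ← hb]
      intro x hx
      rw [Subgroup.mem_upperCentralSeries_succ_iff] at hx
      rw [Subgroup.mem_center_iff]
      intro y
      have := hx y
      rw [ih, Subgroup.mem_bot, commutatorElement_eq_one_iff_mul_comm] at this
      exact this.symm
  obtain ⟨n, hn⟩ := Group.IsNilpotent.nilpotent A
  exact bot_ne_top ((h1 n).symm.trans hn)

-- A non-trivial nilpotent group has a non-trivial centre, a free product of two non-trivial groups
-- has none. Indexing the two factors by `Bool` gives access to reduced words.
open Monoid in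
theorem freelyIndecomposable_of_isNilpotent (A : Type*) [Group A] [Group.IsNilpotent A]
    [Nontrivial A] : FreelyIndecomposable A := by
  classical
  refine ⟨inferInstance, fun B C h => ?_⟩
  by_contra! hne
  let K : Bool → Subgroup A := fun b => bif b then B else C
  let e := MulEquiv.ofBijective _ h
  have heB : ∀ b : B, e.symm b = Coprod.inl b := fun b => by
    rw [MulEquiv.symm_apply_eq]; simp [e]
  have heC : ∀ b : C, e.symm b = Coprod.inr b := fun b => by
    rw [MulEquiv.symm_apply_eq]; simp [e]
  have hK : IsInternalFreeProduct K := by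
    refine isInternalFreeProduct_of_retraction ((Coprod.lift
      (CoprodI.of (M := fun b => K b) (i := true))
      (CoprodI.of (M := fun b => K b) (i := false))).comp e.symm.toMonoidHom) ?_ ?_
    · rintro (_ | _) k
      · rw [MonoidHom.comp_apply]
        erw [heC k]
        rfl
      · rw [MonoidHom.comp_apply]
        erw [heB k]
        rfl
    · have h2 := h.2
      rw [← MonoidHom.range_eq_top, Coprod.range_lift] at h2
      rw [iSup_bool_eq]
      simpa [K] using h2
  have hnt : ∀ b, Nontrivial (K b) := by
    rintro (_ | _)
    · exact (Subgroup.nontrivial_iff_ne_bot C).2 hne.2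
    · exact (Subgroup.nontrivial_iff_ne_bot B).2 hne.1
  have := Group.IsNilpotent.nontrivial_center A
  obtain ⟨⟨z, hz⟩, hz1⟩ := exists_ne (1 : Subgroup.center A)
  let f := hK.equiv
  have h1 : f.symm z = 1 := by
    refine CoprodI.eq_one_of_mem_center hnt (Subgroup.mem_center_iff.2 fun y => ?_)
    apply f.injective
    rw [map_mul, map_mul, f.apply_symm_apply]
    exact Subgroup.mem_center_iff.1 hz _
  apply hz1
  ext
  simpa using h1

theorem hereditarilyIndecomposable_of_isNilpotent (A : Type*) [Group A] [Group.IsNilpotent A]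
    [Infinite A] : HereditarilyIndecomposable A := by
  intro L hL
  have : Nontrivial L := by
    rw [Subgroup.nontrivial_iff_ne_bot]
    rintro rfl
    have := hL.index_ne_zero
    rw [Subgroup.index_bot] at this
    exact this Nat.card_eq_zero_of_infinite
  exact freelyIndecomposable_of_isNilpotent L

theorem HereditarilyIndecomposable.hasFSplitting {A : Type*} [Group A]
    (h : HereditarilyIndecomposable A) : HasFSplitting A 1 := by
  have := hasFSplitting_of_coprodI (A := fun _ : Unit => A)
    (MonoidHom.toMulEquiv (Monoid.CoprodI.lift fun _ => MonoidHom.id A)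
      (Monoid.CoprodI.of (M := fun _ : Unit => A) (i := ())) (by ext i x; simp) (by ext x; simp))
    fun _ => h
  simpa using this

theorem hereditarilyIndecomposable_freeGroup_unit :
    HereditarilyIndecomposable (FreeGroup Unit) :=
  (hereditarilyIndecomposable_of_isNilpotent (Multiplicative ℤ)).of_mulEquiv
    FreeGroup.mulEquivIntOfUnique.symm

theorem hasFSplitting_freeGroup (D : Type*) [Finite D] : HasFSplitting (FreeGroup D) (Nat.card D) :=
  hasFSplitting_of_coprodI freeGroupEquivCoprodI.symm
    fun _ => hereditarilyIndecomposable_freeGroup_unit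

open Monoid in
/-- One factor of a free product can be split off. -/
theorem Monoid.CoprodI.exists_coprod_equiv {ι : Type*} {M : ι → Type*} [∀ i, Group (M i)] (i : ι) :
    ∃ f : Coprod (M i) (CoprodI fun j : {j // j ≠ i} => M j) ≃* CoprodI M,
      ∀ x, f (Coprod.inl x) = CoprodI.of x := by
  classical
  let f : Coprod (M i) (CoprodI fun j : {j // j ≠ i} => M j) →* CoprodI M :=
    Coprod.lift CoprodI.of (CoprodI.lift fun j => CoprodI.of)
  let g : CoprodI M →* Coprod (M i) (CoprodI fun j : {j // j ≠ i} => M j) := CoprodI.lift fun j =>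
    if hj : j = i then @Eq.rec _ i (fun k _ => M k →* Coprod (M i) _) Coprod.inl j hj.symm else
      Coprod.inr.comp (CoprodI.of (M := fun j : {j // j ≠ i} => M j) (i := ⟨j, hj⟩))
  have hgi : ∀ x, g (CoprodI.of (i := i) x) = Coprod.inl x := fun x => by simp [g]
  have hgj : ∀ (j : {j // j ≠ i}) (x : M j), g (CoprodI.of (i := j.1) x) =
      Coprod.inr (CoprodI.of (M := fun j : {j // j ≠ i} => M j) x) := fun j x => by
    simp [g, j.2]
  have hfi : ∀ x, f (Coprod.inl x) = CoprodI.of x := fun x => by simp [f]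
  have hfj : ∀ (j : {j // j ≠ i}) (x : M j),
      f (Coprod.inr (CoprodI.of (M := fun j : {j // j ≠ i} => M j) x)) = CoprodI.of x :=
    fun j x => by
      rw [Coprod.lift_apply_inr]
      exact CoprodI.lift_of _ _
  refine ⟨MonoidHom.toMulEquiv f g ?_ ?_, hfi⟩
  · refine Coprod.hom_ext (MonoidHom.ext fun x => ?_)
      (CoprodI.ext_hom _ _ fun j => MonoidHom.ext fun x => ?_)
    · simp [hfi, hgi]
    · simp only [MonoidHom.comp_apply, hfj, hgj, MonoidHom.id_apply]
  · refine CoprodI.ext_hom _ _ fun j => MonoidHom.ext fun x => ?_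
    by_cases hj : j = i
    · subst hj; simp [hfi, hgi]
    · have h1 := hgj ⟨j, hj⟩ x
      have h2 := hfj ⟨j, hj⟩ x
      simp only at h1 h2
      simp only [MonoidHom.comp_apply, h1, h2, MonoidHom.id_apply]

open Monoid in
/-- In a decomposition of a freely indecomposable group, one of the factors is everything. -/
theorem FreelyIndecomposable.exists_of_surjective {ι : Type*} {M : ι → Type*} [∀ i, Group (M i)]
    (h : FreelyIndecomposable (CoprodI M)) :
    ∃ i, Function.Surjective (CoprodI.of : M i →* CoprodI M) := by
  have : ∃ i, Nontrivial (M i) := by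
    by_contra! hM
    obtain ⟨x, hx⟩ := @exists_ne _ h.1 (1 : CoprodI M)
    have : ∀ y : CoprodI M, y = 1 := fun y => by
      induction y using CoprodI.induction_on with
      | one => rfl
      | of i m => rw [Subsingleton.elim m 1, map_one]
      | mul a b ha hb => rw [ha, hb, one_mul]
    exact hx (this x)
  obtain ⟨i, hi⟩ := this
  obtain ⟨f, hf⟩ := CoprodI.exists_coprod_equiv (M := M) i
  have hQ := (h.subsingleton_or f).resolve_left (not_subsingleton_iff_nontrivial.2 hi)
  refine ⟨i, fun y => ?_⟩
  obtain ⟨x, rfl⟩ := f.surjective y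
  induction x using Coprod.induction_on' with
  | one => exact ⟨1, by simp⟩
  | inl_mul m x ih =>
    obtain ⟨a, ha⟩ := ih
    exact ⟨m * a, by rw [map_mul, map_mul, ha, hf]⟩
  | inr_mul n x ih =>
    rw [Subsingleton.elim n 1, map_one, one_mul]; exact ih

-- Subgroups of fundamental groups, and the Kurosh theorem

universe uV uE uG uC

namespace GraphOfGroups

variable {V : Type uV} {E : Type uE} {G : V → Type uG} [∀ v, Group (G v)] {C : E → Type uC}
  [∀ e, Group (C e)] (Y : GraphOfGroups G C) {T : Set E}

/-- The subgroups that meet no conjugate of an edge group are free products of conjugates of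
subgroups of the vertex groups and of a free group. -/
theorem exists_subgroup_equiv [Fintype V] [Fintype E] (hT : Y.IsSpanningTree T)
    (L : Subgroup (Y.FundamentalGroup T))
    (hL : ∀ e (c : C e) g, g⁻¹ * Y.vertexHom T _ (Y.tgtHom e c) * g ∈ L → c = 1) :
    ∃ (Ω : Type (max uV uE uG)) (v : Ω → V) (S : ∀ ω, Subgroup (G (v ω)))
      (D : Type (max uV uE uG)) (p : Ω → Y.FundamentalGroup T)
      (Ψ : Monoid.Coprod (Monoid.CoprodI fun ω => S ω) (FreeGroup D) ≃* L),
      (∀ ω (s : S ω), (Ψ (Monoid.Coprod.inl (Monoid.CoprodI.of (M := fun ω => S ω) s)) :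
        Y.FundamentalGroup T) = (p ω)⁻¹ * Y.vertexHom T (v ω) s * p ω) ∧
      (L.FiniteIndex → Finite Ω ∧ Finite D ∧ (∀ ω, (S ω).FiniteIndex) ∧
        ∃ m : E → ℕ, (∀ e, m e * Nat.card (C e) = L.index) ∧
          Nat.card D + Nat.card Ω = ∑ e, m e + 1) ∧
      (L.Normal → (∀ ω, S ω = L.comap (Y.vertexHom T (v ω))) ∧
        (L.FiniteIndex → ∀ u, Nat.card {ω // v ω = u} * (L.comap (Y.vertexHom T u)).index =
          L.index)) := by
  classical
  -- The hypothesis on `L` says exactly that the edge groups act freely on the cosets of `L`.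
  let X := Y.FundamentalGroup T ⧸ L
  let _ : ∀ v, MulAction (G v) X := fun v => MulAction.compHom _ (Y.vertexHom T v)
  let _ : ∀ e, MulAction (C e) X := fun e =>
    MulAction.compHom _ ((Y.vertexHom T (Y.tgt e)).comp (Y.tgtHom e))
  have hG : ∀ v (g : G v) (x : X), Y.vertexHom T v g • x = g • x := fun _ _ _ => rfl
  have hC : ∀ e (c : C e) (x : X), Y.tgtHom e c • x = c • x := fun _ _ _ => rfl
  have hfree : ∀ e (c : C e) (x : X), c • x = x → c = 1 := by
    intro e c x
    obtain ⟨g, rfl⟩ := QuotientGroup.mk_surjective x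
    intro h
    have h' : ((Y.vertexHom T _ (Y.tgtHom e c) * g : Y.FundamentalGroup T) : X) = g := h
    refine hL e c g ?_
    have := QuotientGroup.eq.1 h'.symm
    rwa [← mul_assoc] at this
  obtain ⟨ω₀, t, p, Ψ, hΨ⟩ := Y.exists_orbitProduct_equiv hG hC hfree hT
    ((1 : Y.FundamentalGroup T) : X)
  have hstab : MulAction.stabilizer (Y.FundamentalGroup T) ((1 : Y.FundamentalGroup T) : X) = L :=
    MulAction.stabilizer_quotient L
  have hnorm : L.Normal → ∀ v (x : X), MulAction.stabilizer (G v) x =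
      L.comap (Y.vertexHom T v) := by
    intro hN v x
    obtain ⟨g, rfl⟩ := QuotientGroup.mk_surjective x
    ext a
    rw [MulAction.mem_stabilizer_iff, Subgroup.mem_comap]
    change ((Y.vertexHom T v a * g : Y.FundamentalGroup T) : X) = g ↔ _
    rw [eq_comm, QuotientGroup.eq, ← mul_assoc]
    refine ⟨fun h => ?_, fun h => ?_⟩
    · simpa [mul_assoc] using hN.conj_mem _ h g
    · simpa using hN.conj_mem _ h g⁻¹
  refine ⟨OrbitVertex G X, Sigma.fst, fun ω => MulAction.stabilizer (G ω.1) ω.2.out, _, p,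
    Ψ.trans (MulEquiv.subgroupCongr hstab), hΨ, ?_, ?_⟩
  · intro hfin
    have : Finite X := Subgroup.finite_quotient_of_finiteIndex
    have hfo : ∀ v, Finite (MulAction.orbitRel.Quotient (G v) X) := fun v =>
      Quotient.finite _
    have hfe : ∀ e, Finite (MulAction.orbitRel.Quotient (C e) X) := fun v =>
      Quotient.finite _
    refine ⟨inferInstance, inferInstance, fun ω => ⟨?_⟩, fun e =>
      Nat.card (MulAction.orbitRel.Quotient (C e) X), fun e => ?_, ?_⟩
    · rw [MulAction.index_stabilizer]
      exact (Set.ncard_pos (Set.toFinite _)).2 ⟨_, MulAction.mem_orbit_self _⟩ |>.ne'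
    · have hbot : ∀ x : X, MulAction.stabilizer (C e) x = ⊥ := fun x => by
        rw [eq_bot_iff]
        intro c hc
        exact hfree e c x hc
      rw [← Nat.card_prod]
      exact (Nat.card_congr (MulAction.selfEquivOrbitsQuotientProd hbot)).symm
    -- Euler characteristic: a spanning tree has one edge fewer than the graph has vertices.
    · rw [t.card_compl_edges, Nat.card_sigma]
  · intro hN
    refine ⟨fun ω => hnorm hN _ _, fun hfin u => ?_⟩
    have e₁ : {ω : OrbitVertex G X // ω.1 = u} ≃ MulAction.orbitRel.Quotient (G u) X :=
      { toFun := fun ω => ω.2 ▸ ω.1.2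
        invFun := fun q => ⟨⟨u, q⟩, rfl⟩
        left_inv := by rintro ⟨⟨_, q⟩, rfl⟩; rfl
        right_inv := fun q => rfl }
    have e₂ : X ≃ MulAction.orbitRel.Quotient (G u) X × (G u ⧸ L.comap (Y.vertexHom T u)) :=
      (MulAction.selfEquivSigmaOrbitsQuotientStabilizer (G u) X).trans
        ((Equiv.sigmaCongrRight fun q => Subgroup.quotientEquivOfEq (hnorm hN _ _)).trans
          (Equiv.sigmaEquivProd _ _))
    rw [Nat.card_congr e₁]
    exact (Nat.card_prod _ _).symm.trans (Nat.card_congr e₂).symm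

/-- The star with trivial edge groups, centred at `i₀`. -/
def star {ι : Type uV} (M : ι → Type uG) [∀ i, Group (M i)] (i₀ : ι) :
    GraphOfGroups M (fun _ : {i // i ≠ i₀} => PUnit.{uC + 1}) where
  src _ := i₀
  tgt i := i
  srcHom _ := 1
  tgtHom _ := 1
  srcHom_injective _ := Function.injective_of_subsingleton _
  tgtHom_injective _ := Function.injective_of_subsingleton _

section star

variable {ι : Type uV} (M : ι → Type uG) [∀ i, Group (M i)] (i₀ : ι)

theorem star_isSpanningTree : (star.{uV, uG, uC} M i₀).IsSpanningTree Set.univ := by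
  refine ⟨⟨i₀⟩, ?_, ?_⟩
  · have h : ∀ i, (star.{uV, uG, uC} M i₀).Joined Set.univ i₀ i := by
      intro i
      by_cases hi : i = i₀
      · subst hi; exact Relation.EqvGen.refl _
      · exact Relation.EqvGen.rel _ _ ⟨⟨i, hi⟩, trivial, rfl, rfl⟩
    exact fun u v => Relation.EqvGen.trans _ _ _ (Relation.EqvGen.symm _ _ (h u)) (h v)
  · rintro ⟨i, hi⟩ - h
    have key : ∀ u v, (star.{uV, uG, uC} M i₀).Joined (Set.univ \ {⟨i, hi⟩}) u v →
        (u = i ↔ v = i) := by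
      intro u v huv
      induction huv with
      | rel u v h =>
        obtain ⟨⟨j, hj⟩, ⟨-, h2⟩, rfl, rfl⟩ := h
        have h3 : j ≠ i := fun h => h2 (Subtype.ext h)
        exact iff_of_false hi.symm h3
      | refl => rfl
      | symm _ _ _ ih => exact ih.symm
      | trans _ _ _ _ _ h1 h2 => exact h1.trans h2
    exact hi ((key _ _ h).2 rfl).symm

/-- The fundamental group of a star with trivial edge groups is a free product. -/
theorem exists_star_equiv :
    ∃ f : (star.{uV, uG, uC} M i₀).FundamentalGroup Set.univ ≃* Monoid.CoprodI M,
      ∀ i m, f ((star M i₀).vertexHom _ i m) = Monoid.CoprodI.of m := by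
  let Y := star.{uV, uG, uC} M i₀
  let f : Y.FundamentalGroup Set.univ →* Monoid.CoprodI M :=
    Y.fundLift (fun i => Monoid.CoprodI.of) (fun _ => 1)
      (fun e c => by
        have h1 : Y.tgtHom e c = 1 := rfl
        have h2 : Y.srcHom e c = 1 := rfl
        rw [h1, h2, map_one, map_one]) (fun _ _ => rfl)
  let g : Monoid.CoprodI M →* Y.FundamentalGroup Set.univ :=
    Monoid.CoprodI.lift fun i => Y.vertexHom _ i
  have hf : ∀ i m, f (Y.vertexHom _ i m) = Monoid.CoprodI.of m :=
    fun i m => Y.fundLift_vertexHom _ _ _ _ i m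
  have hg : ∀ i (m : M i), g (Monoid.CoprodI.of m) = Y.vertexHom _ i m :=
    fun i m => Monoid.CoprodI.lift_of _ _
  refine ⟨MonoidHom.toMulEquiv f g (MonoidHom.ext fun x => ?_)
    (Monoid.CoprodI.ext_hom _ _ fun i => MonoidHom.ext fun m => ?_), hf⟩
  · rw [MonoidHom.comp_apply, MonoidHom.id_apply]
    induction x using Y.fund_induction with
    | one => simp
    | vertex v m => rw [hf, hg]
    | edge e => rw [Y.edgeElt_eq_one _ (Set.mem_univ e), map_one, map_one]
    | mul a b ha hb => rw [map_mul, map_mul, ha, hb]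
    | inv a ha => rw [map_inv, map_inv, ha]
  · rw [MonoidHom.comp_apply, MonoidHom.comp_apply, hg, hf]; rfl

end star

end GraphOfGroups

/-- **Kurosh subgroup theorem** for free products of finitely many groups. -/
theorem exists_kurosh_equiv {ι : Type uV} [Fintype ι] [Nonempty ι] {M : ι → Type uG}
    [∀ i, Group (M i)] {H : Type uC} [Group H] (f : Monoid.CoprodI M ≃* H) (L : Subgroup H) :
    ∃ (Ω : Type (max uV uG)) (v : Ω → ι) (S : ∀ ω, Subgroup (M (v ω)))
      (D : Type (max uV uG)) (p : Ω → H)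
      (Ψ : Monoid.Coprod (Monoid.CoprodI fun ω => S ω) (FreeGroup D) ≃* L),
      (∀ ω (s : S ω), (Ψ (Monoid.Coprod.inl (Monoid.CoprodI.of (M := fun ω => S ω) s)) : H) =
        (p ω)⁻¹ * f (Monoid.CoprodI.of (s : M (v ω))) * p ω) ∧
      (L.FiniteIndex → Finite Ω ∧ Finite D ∧ (∀ ω, (S ω).FiniteIndex) ∧
        Nat.card D + Nat.card Ω = L.index * (Fintype.card ι - 1) + 1) := by
  classical
  let i₀ := Classical.arbitrary ι
  obtain ⟨f₀, hf₀⟩ := GraphOfGroups.exists_star_equiv.{uV, uG, 0} M i₀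
  let F := f₀.trans f
  have hF : ∀ i m, F ((GraphOfGroups.star M i₀).vertexHom _ i m) = f (Monoid.CoprodI.of m) :=
    fun i m => congrArg f (hf₀ i m)
  obtain ⟨Ω, v, S, D, p, Ψ, hΨ, hfin, -⟩ := (GraphOfGroups.star.{uV, uG, 0} M
    i₀).exists_subgroup_equiv (GraphOfGroups.star_isSpanningTree M i₀) (L.comap F.toMonoidHom)
    (fun _ _ _ _ => rfl)
  let e : L.comap F.toMonoidHom ≃* L := (F.subgroupMap _).trans (MulEquiv.subgroupCongr
    (Subgroup.map_comap_eq_self_of_surjective F.surjective L))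
  have he : ∀ x, (e x : H) = F x := fun _ => rfl
  refine ⟨Ω, v, S, D, fun ω => F (p ω), Ψ.trans e, fun ω s => ?_, fun hL => ?_⟩
  · rw [MulEquiv.trans_apply, he, hΨ, map_mul, map_mul, map_inv, hF]
  · have hidx : (L.comap F.toMonoidHom).index = L.index :=
      Subgroup.index_comap_of_surjective _ F.surjective
    obtain ⟨h1, h2, h3, m, hm, h4⟩ := hfin ⟨by rw [hidx]; exact hL.index_ne_zero⟩
    refine ⟨h1, h2, h3, ?_⟩
    have hm' : ∀ e, m e = L.index := fun e => by
      have := hm e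
      rwa [Nat.card_unique, mul_one, hidx] at this
    rw [h4]
    simp [hm', Fintype.card_subtype_compl, mul_comm]

/-- Finite index subgroups of groups in `𝓕` are in `𝓕`. -/
theorem HasFSplitting.subgroup {H : Type*} [Group H] {n : ℕ} (h : HasFSplitting H n)
    (L : Subgroup H) (hL : L.FiniteIndex) :
    ∃ n' : ℕ, HasFSplitting L n' ∧ (1 - n' : ℚ) = L.index * (1 - n) := by
  obtain ⟨K, hK, hi⟩ := h
  -- The trivial group is separate: a star needs a centre, and `n - 1` would be truncated.
  rcases Nat.eq_zero_or_pos n with rfl | hn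
  · have hs : Subsingleton H := by
      have h1 := hK.iSup_eq_top
      rw [iSup_of_empty] at h1
      exact Subgroup.subsingleton_iff.1 (subsingleton_of_bot_eq_top h1)
    have hLt : L = ⊤ := Subsingleton.elim _ _
    subst hLt
    exact ⟨0, HasFSplitting.of_mulEquiv ⟨K, hK, hi⟩ Subgroup.topEquiv.symm, by simp⟩
  · have : Nonempty (Fin n) := ⟨⟨0, hn⟩⟩
    obtain ⟨Ω, v, S, D, p, Ψ, -, hfin⟩ := exists_kurosh_equiv hK.equiv L
    obtain ⟨h1, h2, h3, h4⟩ := hfin hL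
    have := Fintype.ofFinite Ω
    have hΩ : HasFSplitting (Monoid.CoprodI fun ω => S ω) (Nat.card Ω) :=
      hasFSplitting_of_coprodI (MulEquiv.refl _) fun ω =>
        HereditarilyIndecomposable.subgroup (hi (v ω)) (S ω) (h3 ω)
    refine ⟨_, (hΩ.coprod (hasFSplitting_freeGroup D)).of_mulEquiv Ψ, ?_⟩
    rw [add_comm, h4, Fintype.card_fin]
    push_cast [Nat.cast_sub hn]
    ring

/-- Freely indecomposable subgroups of free products. -/
theorem FreelyIndecomposable.isCyclic_or_conj {H ι : Type*} [Group H] [Finite ι]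
    {K : ι → Subgroup H} (hK : IsInternalFreeProduct K) (L : Subgroup H)
    (hL : FreelyIndecomposable L) :
    IsCyclic L ∨ ∃ i, ∃ p : H, ∀ l ∈ L, p * l * p⁻¹ ∈ K i := by
  have := Fintype.ofFinite ι
  rcases isEmpty_or_nonempty ι with hι | hι
  · have h1 := hK.iSup_eq_top
    rw [iSup_of_empty] at h1
    have : Subsingleton H := Subgroup.subsingleton_iff.1 (subsingleton_of_bot_eq_top h1)
    exact Or.inl inferInstance
  obtain ⟨Ω, v, S, D, p, Ψ, hΨ, -⟩ := exists_kurosh_equiv hK.equiv L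
  rcases hL.subsingleton_or Ψ with hs | hs
  · left
    have e : FreeGroup D ≃* L := (MulEquiv.ofBijective (Monoid.Coprod.inr :
      FreeGroup D →* Monoid.Coprod (Monoid.CoprodI fun ω => S ω) (FreeGroup D))
      ⟨Monoid.Coprod.inr_injective, fun y => by
        induction y using Monoid.Coprod.induction_on' with
        | one => exact ⟨1, map_one _⟩
        | inl_mul m x ih => rw [Subsingleton.elim m 1, map_one, one_mul]; exact ih
        | inr_mul n x ih =>
          obtain ⟨a, rfl⟩ := ih
          exact ⟨n * a, map_mul _ _ _⟩⟩).trans Ψ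
    -- A free group is a free product of infinite cyclic groups, so an indecomposable one is cyclic.
    obtain ⟨d, hd⟩ := (hL.of_mulEquiv (e.symm.trans
      freeGroupEquivCoprodI)).exists_of_surjective
    have h1 : IsCyclic (FreeGroup Unit) :=
      isCyclic_of_surjective (FreeGroup.mulEquivIntOfUnique (α := Unit)).symm
        (MulEquiv.surjective _)
    have h2 := isCyclic_of_surjective _ hd
    exact isCyclic_of_surjective (freeGroupEquivCoprodI.symm.trans e) (MulEquiv.surjective _)
  · right
    have hsurj : ∀ l : L, ∃ y, Ψ (Monoid.Coprod.inl y) = l := by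
      intro l
      obtain ⟨y, rfl⟩ := Ψ.surjective l
      induction y using Monoid.Coprod.induction_on' with
      | one => exact ⟨1, by simp⟩
      | inl_mul m x ih =>
        obtain ⟨a, ha⟩ := ih
        exact ⟨m * a, by rw [map_mul, map_mul, ha, map_mul]⟩
      | inr_mul n x ih => rw [Subsingleton.elim n 1, map_one, one_mul]; exact ih
    have e : (Monoid.CoprodI fun ω => S ω) ≃* L :=
      MulEquiv.ofBijective (Ψ.toMonoidHom.comp Monoid.Coprod.inl)
        ⟨Ψ.injective.comp Monoid.Coprod.inl_injective, hsurj⟩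
    obtain ⟨ω, hω⟩ := (hL.of_mulEquiv e.symm).exists_of_surjective
    refine ⟨v ω, p ω, fun l hl => ?_⟩
    obtain ⟨y, hy⟩ := hsurj ⟨l, hl⟩
    obtain ⟨s, rfl⟩ := hω y
    have h1 := hΨ ω s
    rw [hy] at h1
    simp only at h1
    rw [h1, hK.equiv_of]
    simp [mul_assoc]

/-! ### Uniqueness of the number of factors -/

namespace IsInternalFreeProduct

variable {H ι κ : Type*} [Group H] {K : ι → Subgroup H} {L : κ → Subgroup H}

/-- The homomorphism given by homomorphisms of the factors. -/
noncomputable def lift {B : Type*} [Group B] (hK : IsInternalFreeProduct K) (f : ∀ i, K i →* B) :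
    H →* B :=
  (Monoid.CoprodI.lift f).comp hK.equiv.symm.toMonoidHom

@[simp] theorem lift_coe {B : Type*} [Group B] (hK : IsInternalFreeProduct K)
    (f : ∀ i, K i →* B) (i : ι) (x : K i) : hK.lift f x = f i x := by
  change Monoid.CoprodI.lift f (hK.equiv.symm (x : H)) = _
  rw [hK.equiv_symm_coe]
  exact Monoid.CoprodI.lift_of _ _

theorem hom_ext {B : Type*} [Group B] (hK : IsInternalFreeProduct K) {f g : H →* B}
    (h : ∀ i (x : K i), f x = g x) : f = g := by
  suffices h : f.comp hK.equiv.toMonoidHom = g.comp hK.equiv.toMonoidHom by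
    refine MonoidHom.ext fun x => ?_
    obtain ⟨y, rfl⟩ := hK.equiv.surjective x
    exact DFunLike.congr_fun h y
  refine Monoid.CoprodI.ext_hom _ _ fun i => MonoidHom.ext fun x => ?_
  change f (hK.equiv (Monoid.CoprodI.of (M := fun i => K i) x)) =
    g (hK.equiv (Monoid.CoprodI.of (M := fun i => K i) x))
  rw [hK.equiv_of]
  exact h i x

/-- The projection onto `K i` fixes `x` but kills every other factor, hence also the conjugates of
its elements. -/
theorem index_eq_of_conj_mem (hK : IsInternalFreeProduct K) {i i' : ι} {x q : H} (hx : x ∈ K i)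
    (hx1 : x ≠ 1) (hq : q * x * q⁻¹ ∈ K i') : i' = i := by
  classical
  by_contra hne
  let π : H →* K i := hK.lift (Pi.mulSingle i (MonoidHom.id (K i)))
  have hπ : ∀ j (k : K j), π k =
      Pi.mulSingle (M := fun j => K j →* K i) i (MonoidHom.id (K i)) j k :=
    fun j k => hK.lift_coe _ j k
  have h1 : π x = ⟨x, hx⟩ := by
    rw [hπ i ⟨x, hx⟩, Pi.mulSingle_eq_same]; rfl
  have h2 : π (q * x * q⁻¹) = 1 := by
    rw [hπ i' ⟨_, hq⟩, Pi.mulSingle_eq_of_ne hne]; rfl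
  rw [map_mul, map_mul, map_inv, conj_eq_one_iff, h1] at h2
  exact hx1 (congrArg Subtype.val h2)

theorem exists_noncyclic_conj [Finite κ] (hL : IsInternalFreeProduct L) (A : Subgroup H)
    (hA : FreelyIndecomposable A) (hc : ¬ IsCyclic A) :
    ∃ j : {j // ¬ IsCyclic (L j)}, ∃ p : H, ∀ a ∈ A, p * a * p⁻¹ ∈ L j := by
  obtain ⟨j, p, h⟩ := (hA.isCyclic_or_conj hL).resolve_left hc
  refine ⟨⟨j, fun hj => hc ?_⟩, p, h⟩
  let f : A →* L j := ((MulAut.conj p).toMonoidHom.comp A.subtype).codRestrict _ fun a => h a a.2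
  refine isCyclic_of_injective f fun a b hab => ?_
  have h1 : p * (a : H) * p⁻¹ = p * b * p⁻¹ := congrArg Subtype.val hab
  exact Subtype.ext (by simpa using h1)

/-- By Kurosh each non-cyclic factor is conjugate into a factor of the other splitting, again
non-cyclic. Going there and back conjugates `K i` into some `K i'`, which forces `i' = i`. -/
theorem card_noncyclic_le [Finite ι] [Finite κ] (hK : IsInternalFreeProduct K)
    (hL : IsInternalFreeProduct L) (hKi : ∀ i, FreelyIndecomposable (K i))
    (hLi : ∀ i, FreelyIndecomposable (L i)) :
    Nat.card {i // ¬ IsCyclic (K i)} ≤ Nat.card {j // ¬ IsCyclic (L j)} := by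
  choose f p hf using fun i : {i // ¬ IsCyclic (K i)} =>
    hL.exists_noncyclic_conj (K i) (hKi i) i.2
  choose g q hg using fun j : {j // ¬ IsCyclic (L j)} =>
    hK.exists_noncyclic_conj (L j) (hLi j) j.2
  refine Nat.card_le_card_of_injective f (Function.LeftInverse.injective (g := g) fun i => ?_)
  have := (hKi i).1
  obtain ⟨x, hx⟩ := exists_ne (1 : K i)
  refine Subtype.ext (hK.index_eq_of_conj_mem (q := q (f i) * p i) x.2 (by simpa using hx) ?_)
  have := hg (f i) _ (hf i x x.2)
  simpa [mul_assoc] using this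

theorem card_hom_of_isCyclic (A B : Type*) [Group A] [Infinite A] [IsCyclic A] [Group B] :
    Nat.card (A →* B) = Nat.card B := by
  have e₁ : (A →* B) ≃ (Multiplicative ℤ →* B) :=
    MulEquiv.monoidHomCongrLeftEquiv (intCyclicMulEquiv (G := A)).symm
  exact Nat.card_congr (e₁.trans (zpowersHom _).symm)

/-- This counts the cyclic factors, all infinite, as each contributes a free choice of an element of
`B`. The set of homomorphisms counted is the same for two splittings, since their non-cyclic factors
are conjugate into each other. -/
theorem card_hom_noncyclic [Finite ι] (hK : IsInternalFreeProduct K)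
    (hKi : ∀ i, Infinite (K i)) (B : Type*) [CommGroup B] :
    Nat.card {φ : H →* B // ∀ i, ¬ IsCyclic (K i) → ∀ x ∈ K i, φ x = 1} =
      Nat.card B ^ Nat.card {i // IsCyclic (K i)} := by
  classical
  have := Fintype.ofFinite ι
  let ext : (∀ i : {i // IsCyclic (K i)}, K i →* B) → ∀ i, K i →* B := fun ψ i =>
    if hi : IsCyclic (K i) then ψ ⟨i, hi⟩ else 1
  have hext : ∀ ψ (i : {i // IsCyclic (K i)}), ext ψ i = ψ i := fun ψ i => dif_pos i.2
  have hext' : ∀ ψ i, ¬ IsCyclic (K i) → ext ψ i = 1 := fun ψ i hi => dif_neg hi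
  let e : {φ : H →* B // ∀ i, ¬ IsCyclic (K i) → ∀ x ∈ K i, φ x = 1} ≃
      (∀ i : {i // IsCyclic (K i)}, K i →* B) :=
    { toFun := fun φ i => φ.1.comp (K i).subtype
      invFun := fun ψ => ⟨hK.lift (ext ψ), fun i hi x hx => by
        rw [hK.lift_coe _ i ⟨x, hx⟩, hext' ψ i hi]; rfl⟩
      left_inv := fun φ => by
        refine Subtype.ext (hK.hom_ext fun i x => ?_)
        rw [hK.lift_coe]
        by_cases hi : IsCyclic (K i)
        · exact DFunLike.congr_fun (hext (fun i => φ.1.comp (K i.1).subtype) ⟨i, hi⟩) x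
        · exact (DFunLike.congr_fun (hext' (fun i => φ.1.comp (K i.1).subtype) i hi) x).trans
            (φ.2 i hi x x.2).symm
      right_inv := fun ψ => by
        funext i
        refine MonoidHom.ext fun x => ?_
        rw [MonoidHom.comp_apply, Subgroup.subtype_apply, hK.lift_coe, hext] }
  rw [Nat.card_congr e, Nat.card_pi]
  have h2 : ∀ i : {i // IsCyclic (K i)}, Nat.card (K i →* B) = Nat.card B := by
    intro i
    have := hKi i
    have := i.2
    exact card_hom_of_isCyclic _ _
  rw [Finset.prod_congr rfl fun i _ => h2 i, Finset.prod_const, Finset.card_univ,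
    Nat.card_eq_fintype_card (α := {i // IsCyclic (K i)})]

end IsInternalFreeProduct

theorem HasFSplitting.unique {H : Type*} [Group H] {n m : ℕ} (hn : HasFSplitting H n)
    (hm : HasFSplitting H m) : n = m := by
  obtain ⟨K, hK, hKi⟩ := hn
  obtain ⟨L, hL, hLi⟩ := hm
  have hKi' : ∀ i, FreelyIndecomposable (K i) := fun i =>
    HereditarilyIndecomposable.freelyIndecomposable (hKi i)
  have hLi' : ∀ i, FreelyIndecomposable (L i) := fun i =>
    HereditarilyIndecomposable.freelyIndecomposable (hLi i)
  have h1 : Nat.card {i // ¬ IsCyclic (K i)} = Nat.card {j // ¬ IsCyclic (L j)} :=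
    le_antisymm (hK.card_noncyclic_le hL hKi' hLi') (hL.card_noncyclic_le hK hLi' hKi')
  have hKc := hK.card_hom_noncyclic (fun i => HereditarilyIndecomposable.infinite (hKi i))
    (Multiplicative (ZMod 2))
  have hLc := hL.card_hom_noncyclic (fun i => HereditarilyIndecomposable.infinite (hLi i))
    (Multiplicative (ZMod 2))
  have key : ∀ {a b : ℕ} {K : Fin a → Subgroup H} {L : Fin b → Subgroup H}
      (_ : IsInternalFreeProduct L) (_ : ∀ i, FreelyIndecomposable (K i))
      (φ : H →* Multiplicative (ZMod 2)) (_ : ∀ i, ¬ IsCyclic (L i) → ∀ x ∈ L i, φ x = 1),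
      ∀ i, ¬ IsCyclic (K i) → ∀ x ∈ K i, φ x = 1 := by
    intro a b K L hL hK φ hφ i hi x hx
    obtain ⟨j, p, hp⟩ := hL.exists_noncyclic_conj (K i) (hK i) hi
    have := hφ j j.2 _ (hp x hx)
    rwa [map_mul, map_mul, map_inv, conj_eq_one_iff] at this
  have hZ : Nat.card (Multiplicative (ZMod 2)) = 2 := Nat.card_zmod 2
  rw [hZ] at hKc hLc
  have h2 : 2 ^ Nat.card {i // IsCyclic (K i)} = 2 ^ Nat.card {j // IsCyclic (L j)} := by
    rw [← hKc, ← hLc]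
    exact Nat.card_congr (Equiv.subtypeEquivRight fun φ => ⟨key hK hLi' φ, key hL hKi' φ⟩)
  have h3 := Nat.pow_right_injective le_rfl h2
  have h4 : ∀ {a : ℕ} (p : Fin a → Prop), Nat.card {i // p i} + Nat.card {i // ¬ p i} = a := by
    intro a p
    classical
    rw [← Nat.card_sum, Nat.card_congr (Equiv.sumCompl p), Nat.card_fin]
  have h5 := h4 fun i => IsCyclic (K i)
  have h6 := h4 fun i => IsCyclic (L i)
  omega

/-! ### The invariant `ω` -/

/-- The ratio is unchanged on passing to a finite-index subgroup, so two choices can be compared on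
their intersection. -/
theorem HasFSplitting.inf {G : Type*} [Group G] {H₁ H₂ : Subgroup G} (h₁ : H₁.FiniteIndex)
    (h₂ : H₂.FiniteIndex) {n : ℕ} (hn : HasFSplitting H₁ n) :
    ∃ m : ℕ, HasFSplitting (H₁ ⊓ H₂ : Subgroup G) m ∧
      (1 - m : ℚ) / (H₁ ⊓ H₂).index = (1 - n) / H₁.index := by
  have hidx := Subgroup.relIndex_mul_index (inf_le_left : H₁ ⊓ H₂ ≤ H₁)
  have hfin : (H₁ ⊓ H₂).index ≠ 0 := (inferInstance : (H₁ ⊓ H₂).FiniteIndex).index_ne_zero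
  have hr : ((H₁ ⊓ H₂).subgroupOf H₁).index ≠ 0 := fun h => hfin (by
    rw [← hidx, Subgroup.relIndex, h, zero_mul])
  obtain ⟨m, hm, hm'⟩ := hn.subgroup ((H₁ ⊓ H₂).subgroupOf H₁) ⟨hr⟩
  refine ⟨m, hm.of_mulEquiv (Subgroup.subgroupOfEquivOfLe inf_le_left), ?_⟩
  rw [hm', ← hidx, Subgroup.relIndex, Nat.cast_mul]
  have : (((H₁ ⊓ H₂).subgroupOf H₁).index : ℚ) ≠ 0 := by exact_mod_cast hr
  rw [mul_div_mul_left _ _ this]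

theorem IsOmegaValue.unique {G : Type*} [Group G] {q q' : ℚ} (h : IsOmegaValue G q)
    (h' : IsOmegaValue G q') : q = q' := by
  obtain ⟨H, n, hH, hn, rfl⟩ := h
  obtain ⟨H', n', hH', hn', rfl⟩ := h'
  obtain ⟨m, hm, h1⟩ := hn.inf hH hH'
  obtain ⟨m', hm', h2⟩ := hn'.inf hH' hH
  rw [inf_comm] at hm' h2
  rw [← h1, ← h2, hm.unique hm']

theorem IsOmegaValue.omega_eq {G : Type*} [Group G] {q : ℚ} (h : IsOmegaValue G q) :
    omega G = q := by
  have hex : ∃ q, IsOmegaValue G q := ⟨q, h⟩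
  rw [omega, dif_pos hex]
  exact hex.choose_spec.unique h

theorem IsOmegaValue.subgroup {G : Type*} [Group G] {q : ℚ} (h : IsOmegaValue G q)
    (H : Subgroup G) (hH : H.FiniteIndex) : IsOmegaValue H (H.index * q) := by
  obtain ⟨N, n, hN, hn, rfl⟩ := h
  obtain ⟨m, hm, h1⟩ := hn.inf hN hH
  have hidx := Subgroup.relIndex_mul_index (inf_le_right : N ⊓ H ≤ H)
  have hfin : (N ⊓ H).index ≠ 0 := (inferInstance : (N ⊓ H).FiniteIndex).index_ne_zero
  have hr : ((N ⊓ H).subgroupOf H).index ≠ 0 := fun h => hfin (by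
    rw [← hidx, Subgroup.relIndex, h, zero_mul])
  refine ⟨(N ⊓ H).subgroupOf H, m, ⟨hr⟩,
    hm.of_mulEquiv (Subgroup.subgroupOfEquivOfLe inf_le_right).symm, ?_⟩
  rw [← h1, ← hidx, Subgroup.relIndex, Nat.cast_mul]
  have h2 : (((N ⊓ H).subgroupOf H).index : ℚ) ≠ 0 := by exact_mod_cast hr
  have h3 : (H.index : ℚ) ≠ 0 := by exact_mod_cast hH.index_ne_zero
  field_simp

theorem IsOmegaValue.of_mulEquiv {G G' : Type*} [Group G] [Group G'] {q : ℚ}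
    (h : IsOmegaValue G q) (e : G ≃* G') : IsOmegaValue G' q := by
  obtain ⟨H, n, hH, hn, rfl⟩ := h
  have hidx : (H.map e.toMonoidHom).index = H.index := Subgroup.index_map_equiv H e
  exact ⟨H.map e.toMonoidHom, n, ⟨by rw [hidx]; exact hH.index_ne_zero⟩,
    hn.of_mulEquiv (e.subgroupMap H), by rw [hidx]⟩

/-! ### Finite quotients of the fundamental group -/

/-- Two free actions of a finite group on finite sets of the same cardinality are isomorphic. -/
theorem exists_equiv_of_free {C X₁ X₂ : Type*} [Group C] [Finite C] [Finite X₁] [Finite X₂]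
    (hcard : Nat.card X₁ = Nat.card X₂) (ρ : C →* Equiv.Perm X₁) (σ : C →* Equiv.Perm X₂)
    (hρ : ∀ c x, ρ c x = x → c = 1) (hσ : ∀ c x, σ c x = x → c = 1) :
    ∃ s : X₁ ≃ X₂, ∀ c x, s (ρ c x) = σ c (s x) := by
  let _ : MulAction C X₁ := MulAction.compHom X₁ ρ
  let _ : MulAction C X₂ := MulAction.compHom X₂ σ
  have h₁ : ∀ (c : C) (x : X₁), c • x = x → c = 1 := hρ
  have h₂ : ∀ (c : C) (x : X₂), c • x = x → c = 1 := hσ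
  have hb₁ : ∀ x : X₁, MulAction.stabilizer C x = ⊥ := fun x =>
    eq_bot_iff.2 fun c hc => h₁ c x hc
  have hb₂ : ∀ x : X₂, MulAction.stabilizer C x = ⊥ := fun x =>
    eq_bot_iff.2 fun c hc => h₂ c x hc
  have hq : Nat.card (MulAction.orbitRel.Quotient C X₁) =
      Nat.card (MulAction.orbitRel.Quotient C X₂) := by
    have e₁ := Nat.card_congr (MulAction.selfEquivOrbitsQuotientProd hb₁)
    have e₂ := Nat.card_congr (MulAction.selfEquivOrbitsQuotientProd hb₂)
    rw [Nat.card_prod] at e₁ e₂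
    exact Nat.eq_of_mul_eq_mul_right Nat.card_pos (e₁.symm.trans (hcard.trans e₂))
  have : Finite (MulAction.orbitRel.Quotient C X₁) := Quotient.finite _
  have : Finite (MulAction.orbitRel.Quotient C X₂) := Quotient.finite _
  -- Free actions have `|X| / |C|` orbits; any bijection of orbits extends equivariantly.
  let φ := (Finite.equivFinOfCardEq hq).trans (Finite.equivFin _).symm
  let s : X₁ → X₂ := fun x => orbitElt C x • (φ (orbitClass C x)).out
  have hs : ∀ (c : C) x, s (c • x) = c • s x := fun c x => by
    simp only [s]
    rw [orbitClass_smul, orbitElt_smul_of_free h₁, mul_smul]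
  have hcl : ∀ x, orbitClass C (s x) = φ (orbitClass C x) := fun x => by
    simp only [s]
    rw [orbitClass_smul, orbitClass_out]
  have hinj : Function.Injective s := by
    intro x y hxy
    have h3 : orbitClass C x = orbitClass C y := φ.injective (by rw [← hcl, ← hcl, hxy])
    have h4 : ((orbitElt C y)⁻¹ * orbitElt C x) • (φ (orbitClass C y)).out =
        (φ (orbitClass C y)).out := by
      rw [mul_smul, inv_smul_eq_iff]
      simpa only [s, h3] using hxy
    have h5 := inv_mul_eq_one.1 (h₂ _ _ h4)
    rw [← orbitElt_smul C x, ← orbitElt_smul C y, h5, h3]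
  exact ⟨Equiv.ofBijective s (hinj.bijective_of_nat_card_le hcard.ge), hs⟩

/-- A finite index normal subgroup that avoids a finite set of torsion elements. -/
theorem exists_normal_avoiding {G : Type*} [Group G]
    (h : Group.ResiduallyFinite G ∨ VirtuallyTorsionFree G) (F : Set G) (hF : F.Finite)
    (hFo : ∀ x ∈ F, IsOfFinOrder x) :
    ∃ N : Subgroup G, N.Normal ∧ N.FiniteIndex ∧ ∀ x ∈ F, x ∈ N → x = 1 := by
  rcases h with h | ⟨H, hH, htf⟩
  · have key : ∀ x : G, ∃ N : Subgroup G, N.Normal ∧ N.FiniteIndex ∧ (x ∈ N → x = 1) := by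
      intro x
      by_cases hx : x = 1
      · exact ⟨⊤, inferInstance, inferInstance, fun _ => hx⟩
      · obtain ⟨N, hN⟩ := Group.exists_finiteIndexNormalSubgroup_notMem x hx
        exact ⟨N.toSubgroup, inferInstance, inferInstance, fun h => absurd h hN⟩
    choose N hN hNf hNx using key
    have := hF.to_subtype
    refine ⟨⨅ x : F, N x, Subgroup.normal_iInf_normal fun x => hN x,
      Subgroup.finiteIndex_iInf fun x => hNf x, fun x hx hxN => hNx x ?_⟩
    exact Subgroup.mem_iInf.1 hxN ⟨x, hx⟩
  · exact ⟨H.normalCore, inferInstance, inferInstance, fun x hx hxN =>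
      htf x (H.normalCore_le hxN) (hFo x hx)⟩

/-- The action of a group on a product which has a coset space as one of its factors. -/
def piQuotientPerm {V : Type*} [DecidableEq V] {G : V → Type*} [∀ v, Group (G v)]
    (N : ∀ v, Subgroup (G v)) (v : V) : G v →* Equiv.Perm (∀ v, G v ⧸ N v) :=
  let _ : MulAction (G v) (∀ v, G v ⧸ N v) :=
    { smul := fun g z => Function.update z v (g • z v)
      one_smul := fun z => by
        change Function.update z v ((1 : G v) • z v) = z
        simp
      mul_smul := fun g h z => by
        change Function.update z v ((g * h) • z v) = Function.update (Function.update z v (h • z v))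
          v (g • (Function.update z v (h • z v)) v)
        simp [mul_smul] }
  MulAction.toPermHom _ _

theorem piQuotientPerm_apply_eq_iff {V : Type*} [DecidableEq V] {G : V → Type*}
    [∀ v, Group (G v)] (N : ∀ v, Subgroup (G v)) (hN : ∀ v, (N v).Normal) (v : V) (g : G v)
    (z : ∀ v, G v ⧸ N v) : piQuotientPerm N v g z = z ↔ g ∈ N v := by
  have h1 : piQuotientPerm N v g z = Function.update z v (g • z v) := rfl
  rw [h1, Function.update_eq_self_iff]
  obtain ⟨a, ha⟩ := QuotientGroup.mk_surjective (z v)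
  rw [← ha]
  change ((g * a : G v) : G v ⧸ N v) = a ↔ _
  rw [eq_comm, QuotientGroup.eq, ← mul_assoc]
  refine ⟨fun h => ?_, fun h => ?_⟩
  · simpa [mul_assoc] using (hN v).conj_mem _ h a
  · simpa using (hN v).conj_mem _ h a⁻¹

namespace GraphOfGroups

variable {V E : Type*} {G : V → Type*} [∀ v, Group (G v)] {C : E → Type*}
  [∀ e, Group (C e)] (Y : GraphOfGroups G C) {T : Set E}

/-- Finite index normal subgroups of the vertex groups that meet the edge groups trivially are
induced by one finite index normal subgroup of the fundamental group. -/
theorem exists_normal_comap_eq [Finite V] [Finite E] [∀ e, Finite (C e)] (hT : Y.IsSpanningTree T)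
    (N : ∀ v, Subgroup (G v)) (hN : ∀ v, (N v).Normal) (hfin : ∀ v, (N v).FiniteIndex)
    (hs : ∀ e c, Y.srcHom e c ∈ N _ → c = 1) (ht : ∀ e c, Y.tgtHom e c ∈ N _ → c = 1) :
    ∃ L : Subgroup (Y.FundamentalGroup T), L.Normal ∧ L.FiniteIndex ∧
      ∀ v, L.comap (Y.vertexHom T v) = N v := by
  classical
  have : ∀ v, Finite (G v ⧸ N v) := fun v => Subgroup.finite_quotient_of_finiteIndex
  -- All vertex groups act on this one finite set, and by normality each point has stabilizer `N v`
  -- in `G v`. Each edge group therefore acts freely through both of its ends, and the two actions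
  -- are conjugate by some `σ e`.
  let Z := ∀ v, G v ⧸ N v
  let ρ : ∀ v, G v →* Equiv.Perm Z := piQuotientPerm N
  have hρ : ∀ v g z, ρ v g z = z ↔ g ∈ N v := piQuotientPerm_apply_eq_iff N hN
  have hσ : ∀ e, ∃ s : Equiv.Perm Z, ∀ c z,
      s (ρ _ (Y.tgtHom e c) z) = ρ _ (Y.srcHom e c) (s z) := fun e =>
    exists_equiv_of_free rfl ((ρ _).comp (Y.tgtHom e)) ((ρ _).comp (Y.srcHom e))
      (fun c z h => ht e c ((hρ _ _ _).1 h)) (fun c z h => hs e c ((hρ _ _ _).1 h))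
  choose σ hσ using hσ
  have hσ' : ∀ e c, σ e * ρ _ (Y.tgtHom e c) = ρ _ (Y.srcHom e c) * σ e :=
    fun e c => Equiv.ext fun z => hσ e c z
  obtain ⟨k, hk⟩ := exists_coboundary_of_forest Y.src Y.tgt T.toFinite hT.2.2 σ
  -- Conjugating the vertex actions by `k` turns `σ e` into the identity for `e ∈ T`.
  let θ : Y.FundamentalGroup T →* Equiv.Perm Z := Y.fundLift
    (fun v => (MulAut.conj (k v)⁻¹).toMonoidHom.comp (ρ v))
    (fun e => (k (Y.src e))⁻¹ * σ e * k (Y.tgt e))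
    (fun e c => by
      have := hσ' e c
      simp only [MonoidHom.comp_apply, MulEquiv.toMonoidHom_eq_coe, MonoidHom.coe_coe,
        MulAut.conj_apply, inv_inv, mul_assoc, mul_inv_cancel_left]
      rw [← mul_assoc (σ e), this, mul_assoc])
    (fun e he => by rw [mul_assoc, ← hk e he, inv_mul_cancel])
  have hθ : ∀ v g, θ (Y.vertexHom T v g) = (k v)⁻¹ * ρ v g * k v := fun v g => by
    simp [θ]
  refine ⟨θ.ker, inferInstance, inferInstance, fun v => ?_⟩
  ext g
  rw [Subgroup.mem_comap, MonoidHom.mem_ker, hθ]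
  constructor
  · intro h
    have h1 : ρ v g = 1 := by
      rw [mul_assoc, inv_mul_eq_one] at h
      exact (mul_eq_right.1 h.symm)
    exact (hρ v g fun u => ((1 : G u) : G u ⧸ N u)).1 (by rw [h1]; rfl)
  · intro h
    have h1 : ρ v g = 1 := Equiv.ext fun z => (hρ v g z).2 h
    rw [h1]; group

/-- Each `N v` avoids the finitely many torsion elements coming from edge groups and lies in a
subgroup in `𝓕`. The resulting `L` is normal, so all its vertex groups over `u` are `N u`, and the
factors can be counted fibrewise. -/
theorem isOmegaValue_fundamentalGroup [Fintype V] [Fintype E] [∀ e, Finite (C e)]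
    (hT : Y.IsSpanningTree T) (hG : ∀ v, InVF (G v))
    (hrf : ∀ v, Group.ResiduallyFinite (G v) ∨ VirtuallyTorsionFree (G v)) :
    IsOmegaValue (Y.FundamentalGroup T)
      ((∑ v, omega (G v)) - ∑ e, 1 / (Nat.card (C e) : ℚ)) := by
  classical
  choose H hH n₀ hn₀ using hG
  let F : Set (Σ v, G v) :=
    Set.range (fun x : Σ e, C e => (⟨Y.src x.1, Y.srcHom x.1 x.2⟩ : Σ v, G v)) ∪
      Set.range (fun x : Σ e, C e => (⟨Y.tgt x.1, Y.tgtHom x.1 x.2⟩ : Σ v, G v))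
  have hF : F.Finite := (Set.finite_range _).union (Set.finite_range _)
  have hFo : ∀ x ∈ F, IsOfFinOrder x.2 := by
    rintro _ (⟨⟨e, c⟩, rfl⟩ | ⟨⟨e, c⟩, rfl⟩)
    · exact (Y.srcHom e).isOfFinOrder (isOfFinOrder_of_finite c)
    · exact (Y.tgtHom e).isOfFinOrder (isOfFinOrder_of_finite c)
  choose A hA hAf hAF using fun v => exists_normal_avoiding (hrf v) (Sigma.mk v ⁻¹' F)
    (hF.preimage sigma_mk_injective.injOn) (fun x hx => hFo _ hx)
  let N : ∀ v, Subgroup (G v) := fun v => A v ⊓ (H v).normalCore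
  have hNn : ∀ v, (N v).Normal := fun v => inferInstance
  have hNf : ∀ v, (N v).FiniteIndex := fun v => by
    have := hH v
    have := hAf v
    exact inferInstanceAs (A v ⊓ (H v).normalCore).FiniteIndex
  have hsrc : ∀ e c, Y.srcHom e c ∈ N _ → c = 1 := fun e c h =>
    (injective_iff_map_eq_one _).1 (Y.srcHom_injective e) c
      (hAF _ _ (Or.inl ⟨⟨e, c⟩, rfl⟩) h.1)
  have htgt : ∀ e c, Y.tgtHom e c ∈ N _ → c = 1 := fun e c h =>
    (injective_iff_map_eq_one _).1 (Y.tgtHom_injective e) c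
      (hAF _ _ (Or.inr ⟨⟨e, c⟩, rfl⟩) h.1)
  have hNs : ∀ v, ∃ n, HasFSplitting (N v) n := fun v => by
    obtain ⟨m, hm, -⟩ := (hn₀ v).inf (hH v) (hNf v)
    refine ⟨m, hm.of_mulEquiv (MulEquiv.subgroupCongr ?_)⟩
    exact inf_eq_right.2 (inf_le_right.trans (H v).normalCore_le)
  choose n hn using hNs
  obtain ⟨L, hL, hLf, hLN⟩ := Y.exists_normal_comap_eq hT N hNn hNf hsrc htgt
  obtain ⟨Ω, v, S, D, p, Ψ, -, h1, h2⟩ := Y.exists_subgroup_equiv hT L (fun e c g hc => by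
    have h := hL.conj_mem _ hc g
    refine htgt e c ?_
    rw [← hLN, Subgroup.mem_comap]
    simpa [mul_assoc] using h)
  obtain ⟨hΩ, hD, -, m, hm, hcard⟩ := h1 hLf
  obtain ⟨hS, hcount⟩ := h2 hL
  have hcount := hcount hLf
  have := Fintype.ofFinite Ω
  have hSs : ∀ ω, HasFSplitting (S ω) (n (v ω)) := fun ω =>
    (hn (v ω)).of_mulEquiv (MulEquiv.subgroupCongr (by rw [hS, hLN]))
  refine ⟨L, _, hLf, ((HasFSplitting.coprodI hSs).coprod (hasFSplitting_freeGroup D)).of_mulEquiv Ψ,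
    ?_⟩
  have hL0 : (L.index : ℚ) ≠ 0 := by exact_mod_cast hLf.index_ne_zero
  have hω : ∀ u, omega (G u) = (Nat.card {ω // v ω = u} * (1 - n u : ℚ)) / L.index := by
    intro u
    have h3 : IsOmegaValue (G u) _ := ⟨N u, n u, hNf u, hn u, rfl⟩
    have h4 : ((N u).index : ℚ) ≠ 0 := by exact_mod_cast (hNf u).index_ne_zero
    have h5 : (Nat.card {ω // v ω = u} : ℚ) * (N u).index = L.index := by
      have := hcount u
      rw [hLN] at this
      exact_mod_cast this
    rw [h3.omega_eq, div_eq_div_iff h4 hL0, ← h5]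
    ring
  have hC : ∀ e, 1 / (Nat.card (C e) : ℚ) = m e / L.index := by
    intro e
    have h4 : (Nat.card (C e) : ℚ) ≠ 0 := by exact_mod_cast Nat.card_pos.ne'
    have h5 : (m e : ℚ) * Nat.card (C e) = L.index := by exact_mod_cast hm e
    rw [div_eq_div_iff h4 hL0, ← h5, one_mul]
  have hsum : ∑ ω, (1 - (n (v ω) : ℚ)) = ∑ u, Nat.card {ω // v ω = u} * (1 - n u : ℚ) := by
    rw [← Finset.sum_fiberwise_of_maps_to (fun ω _ => Finset.mem_univ (v ω))]
    refine Finset.sum_congr rfl fun u _ => ?_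
    rw [Finset.sum_congr rfl (g := fun _ => (1 - n u : ℚ))
      (fun ω hω => by rw [(Finset.mem_filter.1 hω).2]), Finset.sum_const, nsmul_eq_mul,
      Nat.card_eq_fintype_card, Fintype.card_subtype]
  have hcard' : (Nat.card D : ℚ) + Nat.card Ω = ∑ e, (m e : ℚ) + 1 := by exact_mod_cast hcard
  rw [Finset.sum_congr rfl fun u _ => hω u, Finset.sum_congr rfl fun e _ => hC e,
    ← Finset.sum_div, ← Finset.sum_div, ← sub_div, ← hsum]
  congr 1
  rw [Finset.sum_sub_distrib, Finset.sum_const, Finset.card_univ, ← Nat.card_eq_fintype_card,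
    nsmul_eq_mul, mul_one]
  push_cast
  linarith

end GraphOfGroups

/-! ### Nilpotent vertex groups and the final statement -/

theorem isOmegaValue_zero_of_isNilpotent (A : Type*) [Group A] [Group.IsNilpotent A]
    [Infinite A] : IsOmegaValue A 0 :=
  ⟨⊤, 1, inferInstance, (hereditarilyIndecomposable_of_isNilpotent A).hasFSplitting.of_mulEquiv
    Subgroup.topEquiv.symm, by simp⟩

theorem IsOmegaValue.inVF {G : Type*} [Group G] {q : ℚ} (h : IsOmegaValue G q) : InVF G := by
  obtain ⟨H, n, hH, hn, -⟩ := h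
  exact ⟨H, hH, n, hn⟩

/-- Isomorphic subgroups share the value `[G : H] * q`, from which a non-zero `q` cancels. -/
theorem IsOmegaValue.index_eq {G : Type*} [Group G] {q : ℚ} (h : IsOmegaValue G q) (hq : q ≠ 0)
    {H₁ H₂ : Subgroup G} (h₁ : H₁.FiniteIndex) (h₂ : H₂.FiniteIndex) (e : H₁ ≃* H₂) :
    H₁.index = H₂.index := by
  have := ((h.subgroup H₁ h₁).of_mulEquiv e).unique (h.subgroup H₂ h₂)
  exact_mod_cast mul_right_cancel₀ hq this

theorem corollary3p6 {V E : Type*} [Fintype V] [Fintype E]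
    (G : V → Type*) [∀ v, Group (G v)] (C : E → Type*) [∀ e, Group (C e)] [∀ e, Finite (C e)]
    (Y : GraphOfGroups G C) (T : Set E) (hT : Y.IsSpanningTree T) :
    ((∀ v, InVF (G v)) → (∀ v, Group.ResiduallyFinite (G v) ∨ VirtuallyTorsionFree (G v)) →
      InVF (Y.FundamentalGroup T) ∧
      (∀ q, IsOmegaValue (Y.FundamentalGroup T) q → q = omega (Y.FundamentalGroup T)) ∧
      omega (Y.FundamentalGroup T) = (∑ v, omega (G v)) - ∑ e, 1 / (Nat.card (C e) : ℚ)) ∧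
    (Nonempty E →
      (∀ v, Infinite (G v) ∧ Group.IsNilpotent (G v) ∧ VirtuallyTorsionFree (G v)) →
      ∀ H₁ H₂ : Subgroup (Y.FundamentalGroup T), H₁.FiniteIndex → H₂.FiniteIndex →
        Nonempty (H₁ ≃* H₂) → H₁.index = H₂.index) := by
  refine ⟨fun hG hrf => ?_, fun hE hG H₁ H₂ h₁ h₂ ⟨e⟩ => ?_⟩
  · have h := Y.isOmegaValue_fundamentalGroup hT hG hrf
    exact ⟨h.inVF, fun q hq => hq.omega_eq.symm, h.omega_eq⟩
  · have hG0 : ∀ v, IsOmegaValue (G v) 0 := fun v => by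
      obtain ⟨hi, hn, -⟩ := hG v
      exact isOmegaValue_zero_of_isNilpotent (G v)
    have h := Y.isOmegaValue_fundamentalGroup hT (fun v => (hG0 v).inVF)
      (fun v => Or.inr (hG v).2.2)
    -- The value is minus a sum of positive terms, non-empty because there is an edge.
    refine h.index_eq (ne_of_lt ?_) h₁ h₂ e
    rw [Finset.sum_congr rfl fun v _ => (hG0 v).omega_eq, Finset.sum_const_zero, zero_sub,
      neg_lt_zero]
    exact Finset.sum_pos (fun e _ => one_div_pos.2 (by exact_mod_cast Nat.card_pos))
      Finset.univ_nonempty
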